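/- Let $M>1$ and $B\ge 0$ be integers. Let $\mathbf h_1,\dots,\mathbf h_M$ be random vectors in $\mathbb C^M$ whose $M^2$ entries are i.i.d. circularly symmetric complex Gaussian with zero mean and unit variance. For each user $i$ let $\mathcal C_i=\{\mathbf w_{i,1},\dots,\mathbf w_{i,2^B}\}$ be a random codebook; all the codewords $\mathbf w_{i,k}$ ($1\le i\le M$, $1\le k\le 2^B$) are independent and isotropically distributed on the unit sphere of $\mathbb C^M$ (their law is invariant under all unitary maps), and they are independent of the channels $\mathbf h_1,\dots,\mathbf h_M$. Let $\hat{\mathbf h}_i=\mathbf w_{i,F_i}$ with $F_i\in\arg\max_{k}|\mathbf h_i^\dagger\mathbf w_{i,k}|$ be the quantization of $\mathbf h_i$, let $\tilde{\mathbf h}_i=\mathbf h_i/\|\mathbf h_i\|$, let $\hat{\mathbf H}=[\hat{\mathbf h}_1\ \cdots\ \hat{\mathbf h}_M]^\dagger$ (almost surely invertible), and let $\mathbf v_j$ be the $j$-th column of $\hat{\mathbf H}^{-1}$ divided by its norm. The angle between two nonzero vectors is given by $\cos\angle(\mathbf x,\mathbf y)=|\mathbf x^\dagger\mathbf y|/(\|\mathbf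 x\|\,\|\mathbf y\|)$, and the quantization error of user $i$ is $Z_i=\sin^2\angle(\tilde{\mathbf h}_i,\hat{\mathbf h}_i)$. Then for all $i\ne j$: 1. if $M\ge 3$, there is a random variable $Y$ with the $\mathrm{Beta}(1,M-2)$ distribution, independent of $Z_i$, such that $|\tilde{\mathbf h}_i^\dagger\mathbf v_j|^2=Z_i\,Y$ almost surely; 2. if $M=2$, then $|\tilde{\mathbf h}_i^\dagger\mathbf v_j|^2=Z_i$ almost surely; 3. in every case, $|\tilde{\mathbf h}_i^\dagger\mathbf v_j|^2\le Z_i$ almost surely. -/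

import Mathlib

open MeasureTheory ProbabilityTheory
open scoped NNReal

namespace RVQ

/-- The space `ℂ^n` of column vectors, with the Euclidean norm. The Hermitian product `x† y` is
`inner ℂ x y` (conjugate-linear in the first argument). -/
abbrev Vec (n : ℕ) : Type := EuclideanSpace ℂ (Fin n)

/-- The circularly symmetric complex Gaussian law with mean zero and unit variance: real and
imaginary parts are independent real Gaussians of variance `1/2`. -/
noncomputable def complexGaussian : Measure ℂ :=
  ((gaussianReal 0 (1 / 2 : ℝ≥0)).prod (gaussianReal 0 (1 / 2 : ℝ≥0))).map
    (fun p : ℝ × ℝ => (⟨p.1, p.2⟩ : ℂ))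

/-- The random vector `X` has the isotropic distribution on the unit sphere of `ℂ^n`: it is almost
surely of norm one and its law is invariant under every unitary transformation. -/
structure IsIsotropicUnit {Ω : Type*} [MeasurableSpace Ω] {n : ℕ} (X : Ω → Vec n)
    (P : Measure Ω) : Prop where
  aemeasurable : AEMeasurable X P
  norm_eq_one : ∀ᵐ ω ∂P, ‖X ω‖ = 1
  map_unitary : ∀ U : Vec n ≃ₗᵢ[ℂ] Vec n, P.map (fun ω => U (X ω)) = P.map X

/-- The angle between two vectors, with `cos = |x† y| / (‖x‖ ‖y‖)`. -/
noncomputable def angle {n : ℕ} (x y : Vec n) : ℝ :=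
  Real.arccos (‖inner ℂ x y‖ / (‖x‖ * ‖y‖))

/-- The normalized vector `x / ‖x‖`. -/
noncomputable def dir {n : ℕ} (x : Vec n) : Vec n := ((‖x‖⁻¹ : ℝ) : ℂ) • x

/-- `k` is a quantization index of the vector `x` for the codebook `c`: it maximizes `|x† c_k|`. -/
def IsQuantIndex {n N : ℕ} (x : Vec n) (c : Fin N → Vec n) (k : Fin N) : Prop :=
  ∀ l : Fin N, ‖inner ℂ x (c l)‖ ≤ ‖inner ℂ x (c k)‖

/-- The matrix `[q_1 ⋯ q_n]†`, whose `i`-th row is `q_i†`. -/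
noncomputable def rowMatrix {n : ℕ} (q : Fin n → Vec n) : Matrix (Fin n) (Fin n) ℂ :=
  Matrix.of fun i m => star (q i m)

/-- The `j`-th zero-forcing beamforming vector for the (quantized) channels `q`: the normalized
`j`-th column of the inverse of `[q_1 ⋯ q_n]†`. -/
noncomputable def zfBeam {n : ℕ} (q : Fin n → Vec n) (j : Fin n) : Vec n :=
  dir (WithLp.toLp 2 fun m => (rowMatrix q)⁻¹ m j)

/-- The quantized channels at the outcome `ω`: `q_i` is the codeword of user `i` with index
`F_i`. -/
def quantized {Ω : Type*} {n N : ℕ} (w : Fin n → Fin N → Ω → Vec n) (F : Fin n → Ω → Fin N)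
    (ω : Ω) : Fin n → Vec n :=
  fun i => w i (F i ω) ω

/-- The quantization error `sin² ∠(x / ‖x‖, q)`. -/
noncomputable def quantError {n : ℕ} (x q : Vec n) : ℝ := Real.sin (angle (dir x) q) ^ 2

/-- The interference term `|(x / ‖x‖)† v_j|²`, where `v_j` is the `j`-th zero-forcing beamforming
vector for `q`. -/
noncomputable def interference {n : ℕ} (x : Vec n) (q : Fin n → Vec n) (j : Fin n) : ℝ :=
  ‖inner ℂ (dir x) (zfBeam q j)‖ ^ 2

end RVQ

namespace RVQ

/-! Write `q_i` for the quantized channel and split the normalized channel of user `i` into its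
projection on `q_i` and the orthogonal `residual`. By Pythagoras the squared norm of the residual is
the quantization error `Z_i`. The zero-forcing vector `v_j` is orthogonal to `q_i`, so the
interference only sees the residual: it equals `Z_i * |⟨s, v_j⟩|²`, where `s` is the residual's
direction. Cauchy-Schwarz gives the upper bound; for `M = 2` the complement of `q_i` is a line
containing `v_j`, whence equality.

For `M ≥ 3`, condition on the channel and codebook of user `i`, which fixes `q_i`, `s` and `Z_i`.
The other quantized channels are independent of these data and isotropic, and `v_j` depends on all
the vectors equivariantly under unitaries. Unitaries fixing `q_i` therefore preserve the conditional
law of `v_j`, which is isotropic on the unit sphere of the complement of `q_i`, of complex dimension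
`M - 1`. Hence `|⟨s, v_j⟩|²` is conditionally `Beta(1, M - 2)`, whatever was conditioned on; this
gives both its law and its independence from `Z_i` (`map_normalizedInterference`,
`exists_beta_factor`).

The Beta law is computed for Gaussian vectors and carried to isotropic ones by randomizing the test
direction (`map_inner_eq_betaMeasure`). The index `F_i` need not be measurable; it is replaced by
`sel`, a measurable unitary-equivariant function that almost surely returns the same codeword,
because ties have probability zero (`ae_sel_eq`). -/

/-! ### The standard complex Gaussian law -/

instance isProbabilityMeasure_complexGaussian : IsProbabilityMeasure complexGaussian := by
  have hm : Measurable (fun p : ℝ × ℝ => (⟨p.1, p.2⟩ : ℂ)) :=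
    Complex.measurableEquivRealProd.symm.measurable
  exact Measure.isProbabilityMeasure_map hm.aemeasurable

theorem charFun_complexGaussian (z : ℂ) :
    charFun complexGaussian z = Complex.exp (-(‖z‖ ^ 2 : ℝ) / 4) := by
  have hm : Measurable (fun p : ℝ × ℝ => (⟨p.1, p.2⟩ : ℂ)) :=
    Complex.measurableEquivRealProd.symm.measurable
  rw [charFun_apply, complexGaussian, integral_map hm.aemeasurable (by fun_prop)]
  have h1 : ∀ p : ℝ × ℝ, Complex.exp ((inner ℝ (⟨p.1, p.2⟩ : ℂ) z : ℝ) * Complex.I)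
      = Complex.exp ((inner ℝ p.1 z.re : ℝ) * Complex.I)
        * Complex.exp ((inner ℝ p.2 z.im : ℝ) * Complex.I) := by
    intro p
    rw [← Complex.exp_add]
    congr 1
    simp [Complex.inner]
    ring
  simp_rw [h1]
  rw [integral_prod_mul (fun x : ℝ => Complex.exp ((inner ℝ x z.re : ℝ) * Complex.I))
    (fun x : ℝ => Complex.exp ((inner ℝ x z.im : ℝ) * Complex.I)),
    ← charFun_apply, ← charFun_apply, charFun_gaussianReal, charFun_gaussianReal,
    ← Complex.exp_add, ← Complex.normSq_eq_norm_sq, Complex.normSq_apply]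
  congr 1
  push_cast
  ring

theorem complexGaussian_eq_withDensity :
    complexGaussian = volume.withDensity
      (fun z : ℂ => ENNReal.ofReal (Real.pi⁻¹ * Real.exp (-‖z‖ ^ 2))) := by
  have hv : (1 / 2 : ℝ≥0) ≠ 0 := by norm_num
  have hd : Measurable (fun z : ℂ => ENNReal.ofReal (Real.pi⁻¹ * Real.exp (-‖z‖ ^ 2))) := by
    fun_prop
  have h : (gaussianReal 0 (1 / 2 : ℝ≥0)).prod (gaussianReal 0 (1 / 2 : ℝ≥0))
      = volume.withDensity (fun p : ℝ × ℝ =>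
        ENNReal.ofReal (Real.pi⁻¹ * Real.exp (-‖(⟨p.1, p.2⟩ : ℂ)‖ ^ 2))) := by
    rw [gaussianReal_of_var_ne_zero 0 hv,
      prod_withDensity (measurable_gaussianPDF _ _) (measurable_gaussianPDF _ _)]
    congr 1
    ext p
    rw [gaussianPDF, gaussianPDF, ← ENNReal.ofReal_mul (gaussianPDFReal_nonneg _ _ _),
      gaussianPDFReal, gaussianPDFReal]
    congr 1
    have : (2 * Real.pi * ((1 / 2 : ℝ≥0) : ℝ)) = Real.pi := by
      push_cast; ring
    rw [this, mul_mul_mul_comm, ← mul_inv, Real.mul_self_sqrt Real.pi_pos.le, ← Real.exp_add,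
      ← Complex.normSq_eq_norm_sq, Complex.normSq_apply]
    congr 2
    push_cast
    ring
  ext s hs
  have hm : MeasurePreserving (fun p : ℝ × ℝ => (⟨p.1, p.2⟩ : ℂ)) volume volume :=
    Complex.volume_preserving_equiv_real_prod.symm
  rw [complexGaussian, Measure.map_apply hm.measurable hs, h,
    withDensity_apply _ (hm.measurable hs), withDensity_apply _ hs,
    ← hm.setLIntegral_comp_preimage hs hd]

/-- The Laplace transform of the unit exponential variable `‖z‖ ^ 2`, used in
`pi_complexGaussian_map_ratio`. -/
theorem integral_exp_neg_mul_complexGaussian {c : ℝ} (hc : 0 ≤ c) :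
    ∫ z, Real.exp (-c * ‖z‖ ^ 2) ∂complexGaussian = (1 + c)⁻¹ := by
  rw [complexGaussian_eq_withDensity, integral_withDensity_eq_integral_toReal_smul (by fun_prop)
    (by simp)]
  have h := Complex.integral_exp_neg_mul_rpow (p := 2) (b := 1 + c) (by norm_num) (by linarith)
  have h2 : ∀ z : ℂ, (ENNReal.ofReal (Real.pi⁻¹ * Real.exp (-‖z‖ ^ 2))).toReal
      • Real.exp (-c * ‖z‖ ^ 2) = Real.pi⁻¹ * Real.exp (-(1 + c) * ‖z‖ ^ (2 : ℝ)) := by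
    intro z
    rw [ENNReal.toReal_ofReal (by positivity), smul_eq_mul, mul_assoc, ← Real.exp_add,
      Real.rpow_two]
    congr 2
    ring
  simp_rw [h2]
  rw [integral_const_mul, h]
  norm_num [Real.rpow_neg_one]

/-- In polar coordinates the angle integrates to `2π`, and the radial density `r * exp (-r ^ 2)` has
an explicit primitive. -/
theorem complexGaussian_norm_sq_gt {t : ℝ} (ht : 0 ≤ t) :
    complexGaussian {z | t < ‖z‖ ^ 2} = ENNReal.ofReal (Real.exp (-t)) := by
  have hS : MeasurableSet {z : ℂ | t < ‖z‖ ^ 2} := measurableSet_lt (by fun_prop) (by fun_prop)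
  rw [complexGaussian_eq_withDensity, withDensity_apply _ hS, ← lintegral_indicator hS,
    ← Complex.lintegral_comp_polarCoord_symm]
  have h1 : ∀ p ∈ polarCoord.target, ENNReal.ofReal p.1 •
      ({z : ℂ | t < ‖z‖ ^ 2}.indicator
        (fun z : ℂ => ENNReal.ofReal (Real.pi⁻¹ * Real.exp (-‖z‖ ^ 2))) (Complex.polarCoord.symm p))
      = (Set.Ioi (Real.sqrt t)).indicator
        (fun r => ENNReal.ofReal (Real.pi⁻¹ * (r * Real.exp (-r ^ 2)))) p.1 * 1 := by
    intro p hp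
    have hp1 : 0 < p.1 := by simpa [polarCoord] using hp.1
    have hn : ‖Complex.polarCoord.symm p‖ = p.1 := by
      rw [Complex.norm_polarCoord_symm, abs_of_pos hp1]
    by_cases h : t < p.1 ^ 2
    · rw [Set.indicator_of_mem (by simpa [hn] using h),
        Set.indicator_of_mem (by simpa using (Real.sqrt_lt' hp1).2 h), hn, smul_eq_mul,
        ← ENNReal.ofReal_mul hp1.le, mul_one]
      congr 1
      ring
    · rw [Set.indicator_of_notMem (by simpa [hn] using h),
        Set.indicator_of_notMem (by simpa [Real.sqrt_lt' hp1] using h)]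
      simp
  rw [setLIntegral_congr_fun (by exact polarCoord.open_target.measurableSet) h1]
  have ht' : polarCoord.target = Set.Ioi (0 : ℝ) ×ˢ Set.Ioo (-Real.pi) Real.pi := rfl
  rw [ht', Measure.volume_eq_prod, ← Measure.prod_restrict,
    lintegral_prod_mul (f := (Set.Ioi (Real.sqrt t)).indicator
        (fun r => ENNReal.ofReal (Real.pi⁻¹ * (r * Real.exp (-r ^ 2))))) (g := fun _ => 1)
      (Measurable.aemeasurable (Measurable.indicator (by fun_prop) measurableSet_Ioi))
      aemeasurable_const]
  rw [lintegral_indicator measurableSet_Ioi, Measure.restrict_restrict measurableSet_Ioi,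
    Set.inter_eq_left.2 (Set.Ioi_subset_Ioi (Real.sqrt_nonneg t)), lintegral_one,
    Measure.restrict_apply_univ, Real.volume_Ioo]
  have hder : ∀ r : ℝ, HasDerivAt (fun r => -(2 * Real.pi)⁻¹ * Real.exp (-r ^ 2))
      (Real.pi⁻¹ * (r * Real.exp (-r ^ 2))) r := by
    intro r
    have := (((hasDerivAt_id r).pow 2).neg.exp).const_mul (-(2 * Real.pi)⁻¹)
    convert! this using 1
    simp
    ring
  have hlim : Filter.Tendsto (fun r : ℝ => -(2 * Real.pi)⁻¹ * Real.exp (-r ^ 2)) Filter.atTop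
      (nhds 0) := by
    have : Filter.Tendsto (fun r : ℝ => Real.exp (-r ^ 2)) Filter.atTop (nhds 0) :=
      Real.tendsto_exp_atBot.comp
        (Filter.tendsto_neg_atTop_atBot.comp (Filter.tendsto_pow_atTop two_ne_zero))
    simpa using this.const_mul (-(2 * Real.pi)⁻¹)
  have hpos : ∀ r ∈ Set.Ioi (Real.sqrt t), 0 ≤ Real.pi⁻¹ * (r * Real.exp (-r ^ 2)) := by
    intro r hr
    have : 0 < r := lt_of_le_of_lt (Real.sqrt_nonneg t) hr
    exact mul_nonneg (inv_nonneg.2 Real.pi_pos.le) (by positivity)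
  have hnn : 0 ≤ᵐ[volume.restrict (Set.Ioi (Real.sqrt t))]
      fun r => Real.pi⁻¹ * (r * Real.exp (-r ^ 2)) :=
    ae_restrict_of_forall_mem measurableSet_Ioi hpos
  have hint := integrableOn_Ioi_deriv_of_nonneg (hder _).continuousAt.continuousWithinAt
    (fun r _ => hder r) hpos hlim
  rw [← ofReal_integral_eq_lintegral_ofReal hint hnn,
    integral_Ioi_of_hasDerivAt_of_tendsto (hder _).continuousAt.continuousWithinAt
    (fun r _ => hder r) hint hlim, ← ENNReal.ofReal_mul (by
      have := Real.pi_pos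
      have := Real.exp_pos (-Real.sqrt t ^ 2)
      have h : 0 ≤ (2 * Real.pi)⁻¹ * Real.exp (-Real.sqrt t ^ 2) := by positivity
      linarith), Real.sq_sqrt ht]
  congr 1
  field_simp
  ring

/-! ### Gaussian vectors and the Beta law -/

/-- The law of a vector of `n` independent standard complex Gaussians. -/
noncomputable def gaussianVec (n : ℕ) : Measure (Vec n) :=
  (Measure.pi fun _ : Fin n => complexGaussian).map (WithLp.toLp 2)

instance isProbabilityMeasure_gaussianVec (n : ℕ) : IsProbabilityMeasure (gaussianVec n) :=
  Measure.isProbabilityMeasure_map (MeasurableEquiv.toLp 2 (Fin n → ℂ)).measurable.aemeasurable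

/-- The characteristic function depends on `‖t‖` alone, and unitary maps preserve the norm. -/
theorem gaussianVec_map_unitary {n : ℕ} (U : Vec n ≃ₗᵢ[ℂ] Vec n) :
    (gaussianVec n).map U = gaussianVec n := by
  have hU : Measurable U := U.continuous.measurable
  -- Characteristic functions use a real inner product; here it is the real part of the Hermitian
  -- one.
  let _ : InnerProductSpace ℝ (Vec n) := PiLp.innerProductSpace (𝕜 := ℝ) (fun _ : Fin n => ℂ)
  have hinner : ∀ x y : Vec n, inner ℝ x y = (inner ℂ x y).re := by
    intro x y
    rw [PiLp.inner_apply, PiLp.inner_apply, Complex.re_sum]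
    refine Finset.sum_congr rfl fun i _ => ?_
    simp [Complex.inner, mul_comm]
  have hc : ∀ t : Vec n, charFun (gaussianVec n) t = Complex.exp (-(‖t‖ ^ 2 : ℝ) / 4) := by
    intro t
    rw [gaussianVec, charFun_pi]
    simp_rw [charFun_complexGaussian]
    rw [← Complex.exp_sum, EuclideanSpace.norm_sq_eq]
    congr 1
    push_cast
    rw [← Finset.sum_div, ← Finset.sum_neg_distrib]
  have : IsProbabilityMeasure ((gaussianVec n).map U) :=
    Measure.isProbabilityMeasure_map hU.aemeasurable
  refine Measure.ext_of_charFun (funext fun t => ?_)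
  rw [charFun_apply, integral_map hU.aemeasurable (by fun_prop), hc]
  have : ∀ x, inner ℝ (U x) t = inner ℝ x (U.symm t) := by
    intro x
    rw [hinner, hinner, U.inner_map_eq_flip]
  simp_rw [this]
  rw [← charFun_apply, hc, U.symm.norm_map]

/-- For first parameter `1` the density on `(0, 1)` is `m * (1 - x) ^ (m - 1)`, with primitive `-(1
- x) ^ m`. -/
theorem betaMeasure_one_Ioi {m : ℕ} (hm : 0 < m) {t : ℝ} (ht0 : 0 ≤ t) (ht1 : t < 1) :
    betaMeasure 1 m (Set.Ioi t) = ENNReal.ofReal ((1 - t) ^ m) := by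
  obtain ⟨k, rfl⟩ : ∃ k, m = k + 1 := ⟨m - 1, by omega⟩
  rw [betaMeasure, withDensity_apply _ measurableSet_Ioi]
  have hbeta : 1 / beta 1 ((k + 1 : ℕ) : ℝ) = k + 1 := by
    have hk : ((k + 1 : ℕ) : ℝ) ≠ 0 := by positivity
    rw [beta, add_comm (1 : ℝ), Real.Gamma_add_one hk, Real.Gamma_one]
    have := (Real.Gamma_pos_of_pos (s := ((k + 1 : ℕ) : ℝ)) (by positivity)).ne'
    field_simp
    push_cast
    ring
  have h1 : ∀ x ∈ Set.Ioi t, betaPDF 1 ((k + 1 : ℕ) : ℝ) x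
      = (Set.Iio (1 : ℝ)).indicator
        (fun x => ENNReal.ofReal (((k : ℝ) + 1) * (1 - x) ^ k)) x := by
    intro x hx
    by_cases hx1 : x < 1
    · rw [Set.indicator_of_mem (Set.mem_Iio.2 hx1), betaPDF_of_pos_lt_one (lt_of_le_of_lt ht0 hx) hx1, hbeta]
      push_cast
      rw [sub_self, Real.rpow_zero, add_sub_cancel_right, Real.rpow_natCast, mul_one]
    · rw [Set.indicator_of_notMem (by simpa using hx1),
        betaPDF_eq_zero_of_one_le (not_lt.1 hx1)]
  rw [setLIntegral_congr_fun measurableSet_Ioi h1, lintegral_indicator measurableSet_Iio,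
    Measure.restrict_restrict measurableSet_Iio, Set.inter_comm, Set.Ioi_inter_Iio,
    Measure.restrict_congr_set Ioo_ae_eq_Ioc,
    ← ofReal_integral_eq_lintegral_ofReal, ← intervalIntegral.integral_of_le ht1.le]
  · have hder : ∀ x ∈ Set.uIcc t 1,
        HasDerivAt (fun x : ℝ => -(1 - x) ^ (k + 1)) (((k : ℝ) + 1) * (1 - x) ^ k) x := by
      intro x _
      have := (((hasDerivAt_id x).const_sub 1).pow (k + 1)).neg
      convert! this using 1
      simp
    rw [intervalIntegral.integral_eq_sub_of_hasDerivAt hder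
      (Continuous.intervalIntegrable (by fun_prop) _ _)]
    simp
  · exact (Continuous.integrableOn_Icc (by fun_prop)).mono_set Set.Ioc_subset_Icc_self
  · refine ae_restrict_of_forall_mem measurableSet_Ioc fun x hx => ?_
    have : 0 ≤ 1 - x := by linarith [hx.2]
    positivity

theorem eq_betaMeasure_one {m : ℕ} (hm : 0 < m) (μ : Measure ℝ) [IsProbabilityMeasure μ]
    (h0 : μ (Set.Iio 0) = 0) (h1 : μ (Set.Ioi 1) = 0)
    (h : ∀ t, 0 ≤ t → t < 1 → μ (Set.Ioi t) = ENNReal.ofReal ((1 - t) ^ m)) :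
    μ = betaMeasure 1 m := by
  have := isProbabilityMeasureBeta (α := 1) (β := m) one_pos (by exact_mod_cast hm)
  have hIoi : ∀ t, μ (Set.Ioi t) = betaMeasure 1 m (Set.Ioi t) →
      μ (Set.Iic t) = betaMeasure 1 m (Set.Iic t) := by
    intro t ht
    rw [← Set.compl_Ioi, prob_compl_eq_one_sub measurableSet_Ioi,
      prob_compl_eq_one_sub measurableSet_Ioi, ht]
  refine Measure.ext_of_Iic _ _ fun t => ?_
  rcases lt_or_ge t 0 with ht | ht
  · rw [measure_mono_null (Set.Iic_subset_Iio.2 ht) h0, betaMeasure,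
      withDensity_apply _ measurableSet_Iic, setLIntegral_eq_zero measurableSet_Iic]
    exact fun x hx => betaPDF_eq_zero_of_nonpos (hx.trans ht.le)
  · refine hIoi t ?_
    rcases lt_or_ge t 1 with ht1 | ht1
    · rw [h t ht ht1, betaMeasure_one_Ioi hm ht ht1]
    · rw [measure_mono_null (Set.Ioi_subset_Ioi ht1) h1, betaMeasure,
        withDensity_apply _ measurableSet_Ioi, setLIntegral_eq_zero measurableSet_Ioi]
      exact fun x hx => betaPDF_eq_zero_of_one_le (ht1.trans (le_of_lt hx))

/-- Given the other coordinates, the ratio exceeds `t` when the exponential variable `‖g 0‖ ^ 2`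
exceeds `c` times the sum of their squares. The exponential tail factorizes over the `m`
coordinates, each contributing its Laplace transform `(1 + c)⁻¹ = 1 - t`. -/
theorem pi_complexGaussian_map_ratio {m : ℕ} (hm : 0 < m) :
    (Measure.pi fun _ : Fin (m + 1) => complexGaussian).map
      (fun g => ‖g 0‖ ^ 2 / ∑ l, ‖g l‖ ^ 2) = betaMeasure 1 m := by
  have hmeas : Measurable (fun g : Fin (m + 1) → ℂ => ‖g 0‖ ^ 2 / ∑ l, ‖g l‖ ^ 2) := by
    fun_prop
  have hprob := Measure.isProbabilityMeasure_map
    (μ := Measure.pi fun _ : Fin (m + 1) => complexGaussian) hmeas.aemeasurable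
  refine eq_betaMeasure_one hm _ ?_ ?_ fun t ht0 ht1 => ?_
  · rw [Measure.map_apply hmeas measurableSet_Iio]
    convert measure_empty (μ := Measure.pi fun _ : Fin (m + 1) => complexGaussian)
    ext g
    simp only [Set.mem_preimage, Set.mem_Iio, Set.mem_empty_iff_false, iff_false, not_lt]
    positivity
  · rw [Measure.map_apply hmeas measurableSet_Ioi]
    convert measure_empty (μ := Measure.pi fun _ : Fin (m + 1) => complexGaussian)
    ext g
    simp only [Set.mem_preimage, Set.mem_Ioi, Set.mem_empty_iff_false, iff_false, not_lt]
    refine div_le_one_of_le₀ ?_ (by positivity)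
    exact Finset.single_le_sum (f := fun l => ‖g l‖ ^ 2) (fun _ _ => by positivity)
      (Finset.mem_univ 0)
  -- `a / (a + b) > t` is equivalent to `a > c * b` for this `c`.
  set c : ℝ := t / (1 - t) with hc
  have hc0 : 0 ≤ c := div_nonneg ht0 (by linarith)
  set S : Set (ℂ × (Fin m → ℂ)) := {p | c * ∑ l, ‖p.2 l‖ ^ 2 < ‖p.1‖ ^ 2} with hS
  have hSm : MeasurableSet S := measurableSet_lt (by fun_prop) (by fun_prop)
  have hmp := measurePreserving_piFinSuccAbove (fun _ : Fin (m + 1) => complexGaussian) 0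
  have hpre : (fun g : Fin (m + 1) → ℂ => ‖g 0‖ ^ 2 / ∑ l, ‖g l‖ ^ 2) ⁻¹' Set.Ioi t
      = MeasurableEquiv.piFinSuccAbove (fun _ => ℂ) 0 ⁻¹' S := by
    ext g
    have hg : (MeasurableEquiv.piFinSuccAbove (fun _ => ℂ) 0 g) = (g 0, fun l : Fin m => g l.succ) := by
      rfl
    rw [Set.mem_preimage, Set.mem_preimage, hg, hS, Set.mem_ofPred_eq, Fin.sum_univ_succ,
      Set.mem_Ioi]
    have ha : 0 ≤ ‖g 0‖ ^ 2 := by positivity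
    have hb : 0 ≤ ∑ l : Fin m, ‖g l.succ‖ ^ 2 := by positivity
    generalize ‖g 0‖ ^ 2 = a at *
    generalize ∑ l : Fin m, ‖g l.succ‖ ^ 2 = b at *
    have h1t : 0 < 1 - t := by linarith
    rw [hc, div_mul_eq_mul_div, div_lt_iff₀ h1t]
    -- At the zero vector the ratio is `0 / 0 = 0`, and both conditions fail since `0 ≤ t`.
    rcases (add_nonneg ha hb).eq_or_lt with h0 | h0
    · have : a = 0 := by linarith
      have : b = 0 := by linarith
      subst_vars
      simp [ht0]
    · rw [lt_div_iff₀ h0]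
      constructor <;> intro h <;> linarith
  rw [Measure.map_apply hmeas measurableSet_Ioi, hpre, hmp.measure_preimage hSm.nullMeasurableSet,
    Measure.prod_apply_symm hSm]
  have hslice : ∀ y : Fin m → ℂ, complexGaussian ((fun x => (x, y)) ⁻¹' S)
      = ENNReal.ofReal (∏ l, Real.exp (-c * ‖y l‖ ^ 2)) := by
    intro y
    have := complexGaussian_norm_sq_gt (t := c * ∑ l, ‖y l‖ ^ 2) (by positivity)
    rw [← Real.exp_sum, ← Finset.mul_sum, neg_mul, ← this]
    rfl
  simp_rw [hslice]
  rw [← ofReal_integral_eq_lintegral_ofReal, integral_fintype_prod_eq_prod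
    (f := fun _ z => Real.exp (-c * ‖z‖ ^ 2))]
  · simp_rw [integral_exp_neg_mul_complexGaussian hc0]
    rw [Finset.prod_const, Finset.card_univ, Fintype.card_fin]
    congr 2
    rw [hc]
    have : 1 - t ≠ 0 := by linarith
    field_simp
    ring
  · refine Integrable.of_bound (C := 1) (Continuous.aestronglyMeasurable (by fun_prop)) (ae_of_all _ fun y => ?_)
    rw [← Real.exp_sum, Real.norm_eq_abs, Real.abs_exp, Real.exp_le_one_iff]
    refine Finset.sum_nonpos fun l _ => ?_
    have : 0 ≤ c * ‖y l‖ ^ 2 := by positivity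
    linarith
  · exact ae_of_all _ fun y => Finset.prod_nonneg fun l _ => (Real.exp_pos _).le

/-! ### Conditioning on one factor of a product measure -/

section Conditioning

variable {A B C : Type*} [MeasurableSpace A] [MeasurableSpace B] [MeasurableSpace C]
  {μ : Measure A} {ν : Measure B} {ρ : Measure C}

/-- If the conditional law of `f` given the first coordinate is almost surely `ρ`, then `f` is
independent of the first coordinate and has law `ρ`. -/
theorem map_prodMk_eq_prod [SFinite ν] [SFinite ρ] {f : A × B → C} (hf : Measurable f)
    (h : ∀ᵐ a ∂μ, ν.map (fun b => f (a, b)) = ρ) :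
    (μ.prod ν).map (fun p => (p.1, f p)) = μ.prod ρ := by
  ext s hs
  have hm : Measurable (fun p : A × B => (p.1, f p)) := by fun_prop
  rw [Measure.map_apply hm hs, Measure.prod_apply (hm hs), Measure.prod_apply hs]
  refine lintegral_congr_ae ?_
  filter_upwards [h] with a ha
  rw [← ha, Measure.map_apply (by fun_prop) (measurable_prodMk_left hs)]
  rfl

theorem map_eq_of_forall_left [SFinite ν] [SFinite ρ] [IsProbabilityMeasure μ] {f : A × B → C}
    (hf : Measurable f) (h : ∀ᵐ a ∂μ, ν.map (fun b => f (a, b)) = ρ) :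
    (μ.prod ν).map f = ρ := by
  have := congrArg (Measure.map Prod.snd) (map_prodMk_eq_prod hf h)
  rw [Measure.map_map measurable_snd (by fun_prop), Measure.map_snd_prod, measure_univ,
    one_smul] at this
  exact this

theorem map_eq_of_forall_right [SFinite μ] [SFinite ρ] [IsProbabilityMeasure ν] {f : A × B → C}
    (hf : Measurable f) (h : ∀ᵐ b ∂ν, μ.map (fun a => f (a, b)) = ρ) :
    (μ.prod ν).map f = ρ := by
  rw [← Measure.prod_swap, Measure.map_map hf measurable_swap]
  exact map_eq_of_forall_left (f := f ∘ Prod.swap) (by fun_prop) h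

end Conditioning

/-! ### Transitivity of unitary maps and the law of isotropic vectors -/

/-- Both families extend to orthonormal bases, and a unitary carries one basis to the other. -/
theorem exists_unitary {n : ℕ} {s : Set (Fin n)} {v v' : Fin n → Vec n}
    (hv : Orthonormal ℂ (s.domRestrict v)) (hv' : Orthonormal ℂ (s.domRestrict v')) :
    ∃ U : Vec n ≃ₗᵢ[ℂ] Vec n, ∀ i ∈ s, U (v i) = v' i := by
  obtain ⟨b, hb⟩ := hv.exists_orthonormalBasis_extension_of_card_eq (by simp)
  obtain ⟨b', hb'⟩ := hv'.exists_orthonormalBasis_extension_of_card_eq (by simp)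
  refine ⟨b.equiv b' (Equiv.refl _), fun i hi => ?_⟩
  rw [← hb i hi, ← hb' i hi, OrthonormalBasis.equiv_apply_basis, Equiv.refl_apply]

theorem exists_unitary_of_norm_eq_one {n : ℕ} {a b : Vec n} (ha : ‖a‖ = 1) (hb : ‖b‖ = 1) :
    ∃ U : Vec n ≃ₗᵢ[ℂ] Vec n, U a = b := by
  have hn : 0 < n := by
    rcases Nat.eq_zero_or_pos n with rfl | h
    · simp [Subsingleton.elim a 0] at ha
    · exact h
  have h : ∀ c : Vec n, ‖c‖ = 1 →
      Orthonormal ℂ (Set.domRestrict {(⟨0, hn⟩ : Fin n)} fun _ => c) := fun c hc =>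
    ⟨fun _ => hc, fun i j hij => (hij (Subsingleton.elim i j)).elim⟩
  obtain ⟨U, hU⟩ := exists_unitary (h a ha) (h b hb)
  exact ⟨U, hU _ rfl⟩

/-- The stabilizer of `q` acts transitively on the unit sphere of the complement of `q`. -/
theorem exists_unitary_of_orthonormal_pair {n : ℕ} {q a b : Vec n} (hq : ‖q‖ = 1)
    (ha : ‖a‖ = 1) (hb : ‖b‖ = 1) (hqa : inner ℂ q a = 0) (hqb : inner ℂ q b = 0) :
    ∃ U : Vec n ≃ₗᵢ[ℂ] Vec n, U q = q ∧ U a = b := by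
  have h : ∀ c : Vec n, ‖c‖ = 1 → inner ℂ q c = 0 → Orthonormal ℂ ![q, c] := by
    intro c hc hqc
    refine ⟨fun i => ?_, fun i j hij => ?_⟩
    · fin_cases i <;> simp [hq, hc]
    · fin_cases i <;> fin_cases j <;> simp_all [inner_eq_zero_symm]
  have hn : 2 ≤ n := by
    have := (h a ha hqa).linearIndependent.fintype_card_le_finrank
    simpa using this
  -- The pair is placed at two indices of `Fin n`, as `exists_unitary` expects; values elsewhere are
  -- irrelevant.
  set e : Fin 2 → Fin n := Fin.castLE hn with he
  have hinj : Function.Injective e := Fin.castLE_injective hn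
  have h' : ∀ c : Vec n, ‖c‖ = 1 → inner ℂ q c = 0 →
      Orthonormal ℂ ((Set.range e).domRestrict (Function.extend e ![q, c] 0)) := by
    intro c hc hqc
    have : (Set.range e).domRestrict (Function.extend e ![q, c] 0)
        = ![q, c] ∘ (Equiv.ofInjective e hinj).symm := by
      ext1 ⟨_, i, rfl⟩
      simp [hinj.extend_apply, Set.domRestrict]
    rw [this]
    exact (h c hc hqc).comp _ (Equiv.injective _)
  obtain ⟨U, hU⟩ := exists_unitary (h' a ha hqa) (h' b hb hqb)
  refine ⟨U, ?_, ?_⟩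
  · simpa [hinj.extend_apply] using hU (e 0) ⟨0, rfl⟩
  · simpa [hinj.extend_apply] using hU (e 1) ⟨1, rfl⟩

theorem gaussianVec_map_ratio {m : ℕ} (hm : 0 < m) {a : Vec (m + 1)} (ha : ‖a‖ = 1) :
    (gaussianVec (m + 1)).map (fun g => ‖(inner ℂ g a : ℂ)‖ ^ 2 / ‖g‖ ^ 2)
      = betaMeasure 1 m := by
  obtain ⟨U, hU⟩ := exists_unitary_of_norm_eq_one
    (b := EuclideanSpace.single (0 : Fin (m + 1)) (1 : ℂ)) ha (by simp)
  have hmeas : Measurable (fun g : Vec (m + 1) =>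
      ‖(inner ℂ g (EuclideanSpace.single (0 : Fin (m + 1)) (1 : ℂ)) : ℂ)‖ ^ 2 / ‖g‖ ^ 2) := by
    fun_prop
  have h1 : (fun g : Vec (m + 1) => ‖(inner ℂ g a : ℂ)‖ ^ 2 / ‖g‖ ^ 2)
      = (fun g => ‖(inner ℂ g (EuclideanSpace.single (0 : Fin (m + 1)) (1 : ℂ)) : ℂ)‖ ^ 2
        / ‖g‖ ^ 2) ∘ U := by
    ext g
    rw [Function.comp_apply, ← hU, U.inner_map_map, U.norm_map]
  rw [h1, ← Measure.map_map hmeas U.continuous.measurable, gaussianVec_map_unitary, gaussianVec,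
    Measure.map_map hmeas (by fun_prop),
    ← pi_complexGaussian_map_ratio hm]
  congr 1
  ext g
  simp [EuclideanSpace.norm_sq_eq, EuclideanSpace.inner_single_right]

theorem betaMeasure_singleton (α β x : ℝ) : betaMeasure α β {x} = 0 :=
  withDensity_absolutelyContinuous _ _ (measure_singleton x)

/-- The ratio of `gaussianVec_map_ratio` vanishes at `g = 0`, and the Beta law has no atom at `0`.
-/
theorem gaussianVec_ae_ne_zero {m : ℕ} (hm : 0 < m) : ∀ᵐ g ∂gaussianVec (m + 1), g ≠ 0 := by
  have h := gaussianVec_map_ratio hm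
    (a := EuclideanSpace.single (0 : Fin (m + 1)) (1 : ℂ)) (by simp)
  have h0 := betaMeasure_singleton 1 m 0
  rw [← h, Measure.map_apply (by fun_prop) (measurableSet_singleton 0)] at h0
  refine measure_mono_null (fun g hg => ?_) h0
  have : g = 0 := by simpa using hg
  simp [this]

/-- Take `g` Gaussian and `x` of law `ν`, independent, and consider `‖⟨J g, x⟩‖ ^ 2 / ‖g‖ ^ 2`.
Given `x = J b` it is a Gaussian ratio, hence Beta. Given `g` its law is that of `‖⟨J s, x⟩‖ ^ 2`,
since by `hconst` the direction of `g` does not matter. The two laws thus agree. The embedding `J`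
covers both the whole space and the complement of a unit vector. -/
theorem map_inner_eq_betaMeasure {m n : ℕ} (hm : 0 < m) (J : Vec (m + 1) →ₗᵢ[ℂ] Vec n)
    (ν : Measure (Vec n)) [IsProbabilityMeasure ν]
    (hν : ∀ᵐ x ∂ν, ∃ b, ‖b‖ = 1 ∧ J b = x)
    (hconst : ∀ s s' : Vec (m + 1), ‖s‖ = 1 → ‖s'‖ = 1 →
      ν.map (fun x => ‖(inner ℂ (J s) x : ℂ)‖ ^ 2) = ν.map (fun x => ‖(inner ℂ (J s') x : ℂ)‖ ^ 2))
    (s : Vec (m + 1)) (hs : ‖s‖ = 1) :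
    ν.map (fun x => ‖(inner ℂ (J s) x : ℂ)‖ ^ 2) = betaMeasure 1 m := by
  have := isProbabilityMeasureBeta (α := 1) (β := m) one_pos (by exact_mod_cast hm)
  have hJ : Measurable J := J.continuous.measurable
  have hf : Measurable (fun p : Vec (m + 1) × Vec n =>
      ‖(inner ℂ (J p.1) p.2 : ℂ)‖ ^ 2 / ‖p.1‖ ^ 2) := by fun_prop
  rw [← map_eq_of_forall_left (μ := gaussianVec (m + 1)) (ν := ν)
    (ρ := ν.map (fun x => ‖(inner ℂ (J s) x : ℂ)‖ ^ 2)) hf]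
  · refine map_eq_of_forall_right hf ?_
    filter_upwards [hν] with x hx
    obtain ⟨b, hb, rfl⟩ := hx
    simp only [J.inner_map_map]
    exact gaussianVec_map_ratio hm hb
  · filter_upwards [gaussianVec_ae_ne_zero hm] with g hg
    have hg' : ‖g‖ ≠ 0 := norm_ne_zero_iff.2 hg
    rw [hconst s (((‖g‖⁻¹ : ℝ) : ℂ) • g) hs (by
      rw [norm_smul, Complex.norm_real, norm_inv, norm_norm, inv_mul_cancel₀ hg'])]
    congr 1
    ext x
    rw [map_smul, inner_smul_left, norm_mul, RCLike.norm_conj, Complex.norm_real, norm_inv,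
      norm_norm, mul_pow, inv_pow, div_eq_inv_mul]

section Isotropic

variable {Ω : Type*} [MeasurableSpace Ω] {P : Measure Ω} [IsProbabilityMeasure P] {n : ℕ}
  {X : Ω → Vec n}

/-- The squared modulus of a coordinate of an isotropic unit vector of `ℂ^(m+1)` is
`Beta(1, m)` distributed. -/
theorem IsIsotropicUnit.map_inner {m : ℕ} (hm : 0 < m) {X : Ω → Vec (m + 1)}
    (hX : IsIsotropicUnit X P) {a : Vec (m + 1)} (ha : ‖a‖ = 1) :
    P.map (fun ω => ‖(inner ℂ a (X ω) : ℂ)‖ ^ 2) = betaMeasure 1 m := by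
  have := Measure.isProbabilityMeasure_map hX.aemeasurable
  have h := map_inner_eq_betaMeasure hm LinearIsometry.id (P.map X) ?_ ?_ a ha
  · rw [AEMeasurable.map_map_of_aemeasurable (by fun_prop) hX.aemeasurable] at h
    exact h
  · rw [ae_map_iff hX.aemeasurable]
    · filter_upwards [hX.norm_eq_one] with ω hω using ⟨X ω, hω, rfl⟩
    · have : {x : Vec (m + 1) | ∃ b, ‖b‖ = 1 ∧ LinearIsometry.id (R := ℂ) b = x}
          = {x | ‖x‖ = 1} := by
        ext x
        simp
      rw [this]
      exact measurableSet_eq_fun (by fun_prop) (by fun_prop)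
  · intro s s' hs hs'
    obtain ⟨U, hU⟩ := exists_unitary_of_norm_eq_one hs hs'
    have hUm := U.continuous.measurable
    conv_rhs => rw [← hX.map_unitary U]
    rw [AEMeasurable.map_map_of_aemeasurable (by fun_prop) hX.aemeasurable,
      AEMeasurable.map_map_of_aemeasurable (f := fun ω => U (X ω)) (by fun_prop)
        (hUm.comp_aemeasurable hX.aemeasurable)]
    congr 1
    ext ω
    simp [← hU]

/-- After scaling `a` to norm one, this is the absence of atoms of the Beta law. -/
theorem IsIsotropicUnit.ae_norm_inner_ne (hn : 1 < n) (hX : IsIsotropicUnit X P) {a : Vec n}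
    (ha : a ≠ 0) (r : ℝ) : ∀ᵐ ω ∂P, ‖(inner ℂ a (X ω) : ℂ)‖ ≠ r := by
  obtain ⟨m, rfl⟩ : ∃ m, n = m + 1 := ⟨n - 1, by omega⟩
  have ha' : ‖a‖ ≠ 0 := norm_ne_zero_iff.2 ha
  have hb : ‖((‖a‖⁻¹ : ℝ) : ℂ) • a‖ = 1 := by
    rw [norm_smul, Complex.norm_real, norm_inv, norm_norm, inv_mul_cancel₀ ha']
  have h := hX.map_inner (by omega) hb
  have hm : AEMeasurable (fun ω => ‖(inner ℂ (((‖a‖⁻¹ : ℝ) : ℂ) • a) (X ω) : ℂ)‖ ^ 2) P := by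
    have := hX.aemeasurable
    fun_prop
  have h0 := betaMeasure_singleton 1 m ((‖a‖⁻¹ * r) ^ 2)
  rw [← h, Measure.map_apply_of_aemeasurable hm (measurableSet_singleton _)] at h0
  refine measure_mono_null (fun ω hω => ?_) h0
  have : ‖(inner ℂ a (X ω) : ℂ)‖ = r := by simpa using hω
  rw [Set.mem_preimage, Set.mem_singleton_iff, inner_smul_left, norm_mul, RCLike.norm_conj,
    Complex.norm_real, norm_inv, norm_norm, this]

theorem IsIsotropicUnit.ae_notMem (hn : 1 < n) (hX : IsIsotropicUnit X P)
    {W : Submodule ℂ (Vec n)} (hW : W ≠ ⊤) : ∀ᵐ ω ∂P, X ω ∉ W := by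
  obtain ⟨a, haW, ha⟩ := Submodule.exists_mem_ne_zero_of_ne_bot
    (mt W.orthogonal_eq_bot_iff.1 hW)
  filter_upwards [hX.ae_norm_inner_ne hn ha 0] with ω hω hmem
  exact hω (by rw [Submodule.inner_left_of_mem_orthogonal hmem haW, norm_zero])

end Isotropic

/-- The analogue of `IsIsotropicUnit.map_inner` for the unit sphere of the orthogonal complement
of a unit vector `q`. -/
theorem map_inner_of_orthogonal {m : ℕ} (hm : 0 < m) {q : Vec (m + 2)} (hq : ‖q‖ = 1)
    (ν : Measure (Vec (m + 2))) [IsProbabilityMeasure ν]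
    (hnorm : ∀ᵐ x ∂ν, ‖x‖ = 1) (horth : ∀ᵐ x ∂ν, (inner ℂ q x : ℂ) = 0)
    (hinv : ∀ U : Vec (m + 2) ≃ₗᵢ[ℂ] Vec (m + 2), U q = q → ν.map U = ν)
    {s : Vec (m + 2)} (hs : ‖s‖ = 1) (hqs : (inner ℂ q s : ℂ) = 0) :
    ν.map (fun x => ‖(inner ℂ s x : ℂ)‖ ^ 2) = betaMeasure 1 m := by
  have : Fact (Module.finrank ℂ (Vec (m + 2)) = m + 1 + 1) := ⟨by simp⟩
  have hq0 : q ≠ 0 := by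
    rintro rfl
    simp at hq
  let b := OrthonormalBasis.fromOrthogonalSpanSingleton (𝕜 := ℂ) (m + 1) hq0
  -- An isometric parametrization of the complement of `q`.
  let J : Vec (m + 1) →ₗᵢ[ℂ] Vec (m + 2) :=
    (ℂ ∙ q)ᗮ.subtypeₗᵢ.comp b.repr.symm.toLinearIsometry
  have hJq : ∀ y, (inner ℂ q (J y) : ℂ) = 0 := fun y =>
    Submodule.mem_orthogonal_singleton_iff_inner_right.1 (b.repr.symm y).2
  have hJ : ∀ x, (inner ℂ q x : ℂ) = 0 → ∃ y, J y = x := fun x hx =>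
    ⟨b.repr ⟨x, Submodule.mem_orthogonal_singleton_iff_inner_right.2 hx⟩, by simp [J]⟩
  obtain ⟨s, rfl⟩ := hJ s hqs
  refine map_inner_eq_betaMeasure hm J ν ?_ ?_ s (by rwa [J.norm_map] at hs)
  · filter_upwards [hnorm, horth] with x hx hqx
    obtain ⟨y, rfl⟩ := hJ x hqx
    exact ⟨y, by rwa [J.norm_map] at hx, rfl⟩
  · intro s s' hs hs'
    obtain ⟨U, hUq, hU⟩ := exists_unitary_of_orthonormal_pair hq
      (a := J s) (b := J s') (by rwa [J.norm_map]) (by rwa [J.norm_map]) (hJq _) (hJq _)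
    conv_rhs => rw [← hinv U hUq]
    rw [Measure.map_map (by fun_prop) U.continuous.measurable]
    congr 1
    ext x
    simp [← hU]

/-! ### Deterministic geometry: residuals, zero-forcing vectors, quantization -/

section Geometry

variable {n N : ℕ}

theorem norm_dir {x : Vec n} (hx : x ≠ 0) : ‖dir x‖ = 1 := by
  rw [dir, norm_smul, Complex.norm_real, norm_inv, norm_norm,
    inv_mul_cancel₀ (norm_ne_zero_iff.2 hx)]

theorem norm_smul_dir (x : Vec n) : (‖x‖ : ℂ) • dir x = x := by
  rcases eq_or_ne x 0 with rfl | hx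
  · simp
  · rw [dir, smul_smul, ← Complex.ofReal_mul, mul_inv_cancel₀ (norm_ne_zero_iff.2 hx),
      Complex.ofReal_one, one_smul]

theorem norm_dir_le (x : Vec n) : ‖dir x‖ ≤ 1 := by
  rcases eq_or_ne x 0 with rfl | hx
  · simp [dir]
  · exact (norm_dir hx).le

theorem dir_map_unitary (U : Vec n ≃ₗᵢ[ℂ] Vec n) (x : Vec n) : dir (U x) = U (dir x) := by
  rw [dir, dir, U.norm_map, map_smul]

@[fun_prop]
theorem measurable_dir : Measurable (dir : Vec n → Vec n) := by
  unfold dir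
  fun_prop

/-- The component of `x / ‖x‖` orthogonal to the unit vector `q`. -/
noncomputable def residual (x q : Vec n) : Vec n := dir x - (inner ℂ q (dir x) : ℂ) • q

theorem measurable_residual : Measurable (fun p : Vec n × Vec n => residual p.1 p.2) := by
  unfold residual
  fun_prop

theorem inner_residual {x q : Vec n} (hq : ‖q‖ = 1) : (inner ℂ q (residual x q) : ℂ) = 0 := by
  rw [residual, inner_sub_right, inner_smul_right, inner_self_eq_norm_sq_to_K, hq]
  simp

/-- Pythagoras for the decomposition of `dir x` along `q`. -/
theorem quantError_eq {x q : Vec n} (hx : x ≠ 0) (hq : ‖q‖ = 1) :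
    quantError x q = ‖residual x q‖ ^ 2 := by
  have hd := norm_dir hx
  have hle : ‖(inner ℂ (dir x) q : ℂ)‖ ≤ 1 := by
    simpa [hd, hq] using norm_inner_le_norm (𝕜 := ℂ) (dir x) q
  have hpyth : ‖dir x‖ ^ 2 = ‖residual x q‖ ^ 2 + ‖(inner ℂ q (dir x) : ℂ)‖ ^ 2 := by
    have h : dir x = residual x q + (inner ℂ q (dir x) : ℂ) • q := by simp [residual]
    have h0 : (inner ℂ (residual x q) ((inner ℂ q (dir x) : ℂ) • q) : ℂ) = 0 := by
      rw [inner_smul_right, inner_eq_zero_symm.1 (inner_residual hq), mul_zero]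
    have := norm_add_sq_eq_norm_sq_add_norm_sq_of_inner_eq_zero _ _ h0
    rw [← h, norm_smul, hq, mul_one] at this
    nlinarith
  rw [quantError, angle, hd, hq, mul_one, div_one, Real.sin_arccos, Real.sq_sqrt]
  · rw [norm_inner_symm (𝕜 := ℂ) q, hd] at hpyth
    linarith
  · nlinarith [norm_nonneg (inner ℂ (dir x) q : ℂ)]

theorem residual_ne_zero {x q : Vec n} (hx : x ≠ 0)
    (h : q ∉ Submodule.span ℂ {x}) : residual x q ≠ 0 := by
  intro h0
  have h1 : dir x = (inner ℂ q (dir x) : ℂ) • q := sub_eq_zero.1 h0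
  have hc : (inner ℂ q (dir x) : ℂ) ≠ 0 := by
    intro hc
    have := norm_dir hx
    rw [h1, hc, zero_smul, norm_zero] at this
    exact zero_ne_one this
  refine h (Submodule.mem_span_singleton.2
    ⟨(inner ℂ q (dir x) : ℂ)⁻¹ * ((‖x‖⁻¹ : ℝ) : ℂ), ?_⟩)
  rw [mul_smul, ← dir]
  nth_rewrite 2 [h1]
  rw [smul_smul, inv_mul_cancel₀ hc, one_smul]

/-- The unnormalized zero-forcing vector. -/
noncomputable def zfCol (q : Fin n → Vec n) (j : Fin n) : Vec n :=
  WithLp.toLp 2 fun m => (rowMatrix q)⁻¹ m j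

theorem rowMatrix_mulVec (q : Fin n → Vec n) (x : Vec n) (i : Fin n) :
    ((rowMatrix q).mulVec x.ofLp) i = inner ℂ (q i) x := by
  simp [rowMatrix, Matrix.mulVec, dotProduct, PiLp.inner_apply, mul_comm]

theorem isUnit_det_rowMatrix_iff {q : Fin n → Vec n} :
    IsUnit (rowMatrix q).det ↔ LinearIndependent ℂ q := by
  have h1 : rowMatrix q = (Matrix.of fun i m => q i m).map (starRingEnd ℂ) := rfl
  rw [h1, ← RingHom.mapMatrix_apply, ← RingHom.map_det, isUnit_iff_ne_zero,
    map_ne_zero_iff _ (starRingEnd ℂ).injective, ← isUnit_iff_ne_zero, ← Matrix.isUnit_iff_isUnit_det,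
    ← Matrix.linearIndependent_rows_iff_isUnit]
  exact (LinearMap.linearIndependent_iff
    (WithLp.linearEquiv 2 ℂ (Fin n → ℂ)).toLinearMap (LinearEquiv.ker _))

theorem inner_zfCol {q : Fin n → Vec n} (hq : LinearIndependent ℂ q) (i j : Fin n) :
    (inner ℂ (q i) (zfCol q j) : ℂ) = if i = j then 1 else 0 := by
  have h := Matrix.mul_nonsing_inv _ (isUnit_det_rowMatrix_iff.2 hq)
  rw [← rowMatrix_mulVec, ← Matrix.one_apply, ← h]
  rfl

/-- The columns form the dual basis of `q`; this characterization yields unitary equivariance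
without computing an inverse. -/
theorem eq_zfCol {q : Fin n → Vec n} (hq : LinearIndependent ℂ q) {j : Fin n} {x : Vec n}
    (hx : ∀ i, (inner ℂ (q i) x : ℂ) = if i = j then 1 else 0) : x = zfCol q j := by
  have h : (rowMatrix q).mulVec x.ofLp = (rowMatrix q).mulVec (zfCol q j).ofLp := by
    ext i
    rw [rowMatrix_mulVec, rowMatrix_mulVec, hx, inner_zfCol hq]
  have := Matrix.mulVec_injective_of_isUnit
    ((Matrix.isUnit_iff_isUnit_det _).2 (isUnit_det_rowMatrix_iff.2 hq)) h
  exact (WithLp.ofLp_injective 2) this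

/-- A singular matrix has inverse `0` by convention, so equivariance and orthogonality hold with no
independence assumption. -/
theorem zfCol_of_not_linearIndependent {q : Fin n → Vec n} (hq : ¬ LinearIndependent ℂ q)
    (j : Fin n) : zfCol q j = 0 := by
  ext m
  simp [zfCol, Matrix.nonsing_inv_apply_not_isUnit _ (mt isUnit_det_rowMatrix_iff.1 hq)]

theorem linearIndependent_unitary_iff (U : Vec n ≃ₗᵢ[ℂ] Vec n) {q : Fin n → Vec n} :
    LinearIndependent ℂ (fun i => U (q i)) ↔ LinearIndependent ℂ q :=
  LinearMap.linearIndependent_iff U.toLinearEquiv.toLinearMap (LinearEquiv.ker _)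

theorem zfBeam_map_unitary (U : Vec n ≃ₗᵢ[ℂ] Vec n) (q : Fin n → Vec n) (j : Fin n) :
    zfBeam (fun i => U (q i)) j = U (zfBeam q j) := by
  have h : zfCol (fun i => U (q i)) j = U (zfCol q j) := by
    by_cases hq : LinearIndependent ℂ q
    · refine (eq_zfCol ((linearIndependent_unitary_iff U).2 hq) fun i => ?_).symm
      rw [U.inner_map_map, inner_zfCol hq]
    · rw [zfCol_of_not_linearIndependent hq, map_zero,
        zfCol_of_not_linearIndependent (mt (linearIndependent_unitary_iff U).1 hq)]
  change dir (zfCol _ j) = U (dir (zfCol q j))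
  rw [h, dir_map_unitary]

theorem norm_zfBeam {q : Fin n → Vec n} (hq : LinearIndependent ℂ q) (j : Fin n) :
    ‖zfBeam q j‖ = 1 := by
  refine norm_dir fun h => ?_
  have h1 := inner_zfCol hq j j
  rw [show zfCol q j = 0 from h] at h1
  simp at h1

theorem inner_zfBeam (q : Fin n → Vec n) {i j : Fin n} (hij : i ≠ j) :
    (inner ℂ (q i) (zfBeam q j) : ℂ) = 0 := by
  change (inner ℂ (q i) (dir (zfCol q j)) : ℂ) = 0
  rw [dir, inner_smul_right]
  by_cases hq : LinearIndependent ℂ q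
  · rw [inner_zfCol hq, if_neg hij, mul_zero]
  · rw [zfCol_of_not_linearIndependent hq, inner_zero_right, mul_zero]

theorem measurable_zfBeam (j : Fin n) : Measurable (fun q : Fin n → Vec n => zfBeam q j) := by
  have hrow : Continuous (rowMatrix : (Fin n → Vec n) → _) := by
    refine continuous_matrix fun i m => ?_
    simp only [rowMatrix, Matrix.of_apply]
    fun_prop
  have hcol : Measurable (fun q : Fin n → Vec n => zfCol q j) := by
    refine (WithLp.measurable_toLp 2 _).comp (measurable_pi_iff.2 fun m => ?_)
    simp only [Matrix.inv_def, Matrix.smul_apply, Ring.inverse_eq_inv', smul_eq_mul]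
    have h1 : Measurable fun q : Fin n → Vec n => (rowMatrix q).det := hrow.matrix_det.measurable
    have h2 : Measurable fun q : Fin n → Vec n => (rowMatrix q).adjugate m j :=
      (hrow.matrix_adjugate.matrix_elem m j).measurable
    exact h1.inv.mul h2
  exact measurable_dir.comp hcol

theorem interference_eq (x : Vec n) (q : Fin n → Vec n) {i j : Fin n} (hij : i ≠ j) :
    interference x q j = ‖(inner ℂ (residual x (q i)) (zfBeam q j) : ℂ)‖ ^ 2 := by
  rw [interference, residual, inner_sub_left, inner_smul_left, inner_zfBeam q hij, mul_zero,
    sub_zero]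

/-- Cauchy-Schwarz; `‖dir x‖ ≤ 1` holds even for `x = 0`, so a degenerate family `q` is allowed. -/
theorem interference_le {x : Vec n} (hx : x ≠ 0) {q : Fin n → Vec n} {i j : Fin n} (hij : i ≠ j)
    (hq : ‖q i‖ = 1) : interference x q j ≤ quantError x (q i) := by
  rw [interference_eq x q hij, quantError_eq hx hq]
  gcongr
  exact (norm_inner_le_norm _ _).trans
    (mul_le_of_le_one_right (norm_nonneg _) (norm_dir_le _))

theorem interference_eq_mul {x : Vec n} (hx : x ≠ 0) {q : Fin n → Vec n} {i j : Fin n}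
    (hij : i ≠ j) (hq : ‖q i‖ = 1) :
    interference x q j
      = quantError x (q i) * ‖(inner ℂ (dir (residual x (q i))) (zfBeam q j) : ℂ)‖ ^ 2 := by
  rw [interference_eq x q hij, quantError_eq hx hq]
  nth_rewrite 1 [← norm_smul_dir (residual x (q i))]
  rw [inner_smul_left, norm_mul, mul_pow]
  simp

/-- In dimension two `q i` and `zfBeam q j` form an orthonormal basis; Parseval for the residual
leaves only the second coefficient. -/
theorem interference_eq_of_two {x : Vec 2} (hx : x ≠ 0) {q : Fin 2 → Vec 2} {i j : Fin 2}
    (hij : i ≠ j) (hq : ‖q i‖ = 1) (hLI : LinearIndependent ℂ q) :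
    interference x q j = quantError x (q i) := by
  rw [interference_eq x q hij, quantError_eq hx hq]
  have hon : Orthonormal ℂ ![q i, zfBeam q j] := by
    refine ⟨fun k => ?_, fun k l hkl => ?_⟩
    · fin_cases k <;> simp [hq, norm_zfBeam hLI]
    · have := inner_zfBeam q hij
      fin_cases k <;> fin_cases l <;> simp_all [inner_eq_zero_symm]
  obtain ⟨b, hb⟩ := Orthonormal.exists_orthonormalBasis_extension_of_card_eq (𝕜 := ℂ)
    (E := Vec 2) (ι := Fin 2) (v := ![q i, zfBeam q j]) (s := Set.univ) (by simp)
    (hon.comp _ Subtype.val_injective)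
  have := b.sum_sq_norm_inner_left (residual x (q i))
  rw [Fin.sum_univ_two, hb 0 trivial, hb 1 trivial] at this
  simp only [Matrix.cons_val_zero, Matrix.cons_val_one] at this
  rw [← this, inner_eq_zero_symm.1 (inner_residual hq)]
  simp

/-- The quantization of `x` with the codebook `c`, when the quantization index is unique. -/
noncomputable def sel (x : Vec n) (c : Fin N → Vec n) : Vec n :=
  open Classical in ∑ k, if IsQuantIndex x c k then c k else 0

theorem measurable_sel :
    Measurable (fun p : Vec n × (Fin N → Vec n) => sel p.1 p.2) := by
  classical
  unfold sel
  refine Finset.measurable_sum _ fun k _ => Measurable.ite ?_ (by fun_prop) (by fun_prop)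
  simp only [IsQuantIndex, Set.ofPred_forall]
  exact MeasurableSet.iInter fun l => measurableSet_le (by fun_prop) (by fun_prop)

theorem sel_map_unitary (U : Vec n ≃ₗᵢ[ℂ] Vec n) (x : Vec n) (c : Fin N → Vec n) :
    sel (U x) (fun k => U (c k)) = U (sel x c) := by
  classical
  have h : ∀ k, IsQuantIndex (U x) (fun k => U (c k)) k ↔ IsQuantIndex x c k := fun k => by
    simp only [IsQuantIndex, U.inner_map_map]
  rw [sel, sel, map_sum]
  refine Finset.sum_congr rfl fun k _ => ?_
  by_cases hk : IsQuantIndex x c k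
  · rw [if_pos hk, if_pos ((h k).2 hk)]
  · rw [if_neg hk, if_neg (mt (h k).1 hk), map_zero]

theorem sel_eq {x : Vec n} {c : Fin N → Vec n} {k : Fin N} (hk : IsQuantIndex x c k)
    (h : ∀ l, l ≠ k → ‖(inner ℂ x (c l) : ℂ)‖ ≠ ‖(inner ℂ x (c k) : ℂ)‖) : sel x c = c k := by
  classical
  rw [sel, Finset.sum_eq_single k, if_pos hk]
  · exact fun l _ hl => if_neg fun hlq => h l hl (le_antisymm (hk l) (hlq k))
  · simp

attribute [irreducible] sel residual zfCol

end Geometry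

/-! ### Regrouping independent families and Fubini -/

section Independence

variable {Ω : Type*} [MeasurableSpace Ω] {P : Measure Ω}

/-- Independence says that the joint law is a product measure, and currying a product measure gives
a product of products. -/
theorem iIndepFun_curry {ι κ β : Type*} [Fintype ι] [Fintype κ] [MeasurableSpace β]
    {X : ι × κ → Ω → β} (hm : ∀ p, AEMeasurable (X p) P) (h : iIndepFun X P) :
    iIndepFun (fun i ω j => X (i, j) ω) P := by
  have := h.isProbabilityMeasure
  have := fun p => Measure.isProbabilityMeasure_map (hm p)
  have hm' : ∀ i, AEMeasurable (fun ω j => X (i, j) ω) P := fun i =>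
    aemeasurable_pi_lambda _ fun j => hm (i, j)
  have h1 := h.map_fun_eq_infinitePi_map₀' hm
  have h2 : ∀ i, P.map (fun ω j => X (i, j) ω)
      = Measure.infinitePi (fun j => P.map (X (i, j))) := fun i =>
    (h.precomp (Prod.mk_right_injective i)).map_fun_eq_infinitePi_map₀' fun j => hm (i, j)
  rw [iIndepFun_iff_map_fun_eq_infinitePi_map₀' hm']
  simp_rw [h2]
  rw [← Measure.infinitePi_map_curry (fun i j => P.map (X (i, j))), ← h1,
    AEMeasurable.map_map_of_aemeasurable (by fun_prop) (aemeasurable_pi_lambda _ hm)]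
  rfl

theorem iIndepFun_prodMk {ι α β : Type*} [Fintype ι] [MeasurableSpace α] [MeasurableSpace β]
    {X : ι → Ω → α} {Y : ι → Ω → β} (hXm : ∀ i, AEMeasurable (X i) P)
    (hYm : ∀ i, AEMeasurable (Y i) P) (hX : iIndepFun X P) (hY : iIndepFun Y P)
    (hXY : IndepFun (fun ω i => X i ω) (fun ω i => Y i ω) P) :
    iIndepFun (fun i ω => (X i ω, Y i ω)) P := by
  have := hX.isProbabilityMeasure
  have := fun i => Measure.isProbabilityMeasure_map (hXm i)
  have := fun i => Measure.isProbabilityMeasure_map (hYm i)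
  have hXm' := aemeasurable_pi_lambda _ hXm
  have hYm' := aemeasurable_pi_lambda _ hYm
  have h1 : ∀ i, P.map (fun ω => (X i ω, Y i ω)) = (P.map (X i)).prod (P.map (Y i)) := fun i =>
    (indepFun_iff_map_prod_eq_prod_map_map (hXm i) (hYm i)).1
      (hXY.comp (measurable_pi_apply i) (measurable_pi_apply i))
  have h2 := (indepFun_iff_map_prod_eq_prod_map_map hXm' hYm').1 hXY
  rw [hX.map_fun_eq_pi_map hXm, hY.map_fun_eq_pi_map hYm] at h2
  rw [iIndepFun_iff_map_fun_eq_pi_map fun i => (hXm i).prodMk (hYm i)]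
  simp_rw [h1]
  have hmp := (measurePreserving_arrowProdEquivProdArrow α β ι (fun i => P.map (X i))
    (fun i => P.map (Y i))).symm
  rw [← hmp.map_eq, ← h2, AEMeasurable.map_map_of_aemeasurable (by fun_prop) (hXm'.prodMk hYm')]
  rfl

/-- Fubini: a property of an independent pair may be checked with `X` frozen at one outcome and `Y`
sampled at another. -/
theorem IndepFun.ae_of_ae_ae [IsProbabilityMeasure P] {α β : Type*} [MeasurableSpace α]
    [MeasurableSpace β] {X : Ω → α} {Y : Ω → β} (h : IndepFun X Y P) (hX : AEMeasurable X P)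
    (hY : AEMeasurable Y P) {p : α × β → Prop} (hp : MeasurableSet {q | p q})
    (hae : ∀ᵐ ω ∂P, ∀ᵐ ω' ∂P, p (X ω, Y ω')) : ∀ᵐ ω ∂P, p (X ω, Y ω) := by
  have := Measure.isProbabilityMeasure_map hX
  have := Measure.isProbabilityMeasure_map hY
  have hlaw := (indepFun_iff_map_prod_eq_prod_map_map hX hY).1 h
  have hs : ∀ x, MeasurableSet {y | p (x, y)} := fun x => measurable_prodMk_left hp
  rw [← ae_map_iff (hX.prodMk hY) hp, hlaw, Measure.ae_prod_iff_ae_ae hp, ae_map_iff hX]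
  · filter_upwards [hae] with ω hω
    rwa [ae_map_iff hY (hs _)]
  · have hm := measurable_measure_prodMk_left (ν := P.map Y) hp.compl
    exact hm (measurableSet_singleton 0)

end Independence

/-! ### Almost sure general position and isotropy of the quantized channels -/

section RandomVectors

variable {Ω : Type*} [MeasurableSpace Ω] {P : Measure Ω} [IsProbabilityMeasure P] {n : ℕ}

/-- As many independent isotropic unit vectors as the dimension are almost surely linearly
independent. -/
theorem ae_linearIndependent (hn : 1 < n) {Q : Fin n → Ω → Vec n}
    (hQ : ∀ i, IsIsotropicUnit (Q i) P) (hind : iIndepFun Q P) :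
    ∀ᵐ ω ∂P, LinearIndependent ℂ (fun i => Q i ω) := by
  classical
  have key : ∀ s : Finset (Fin n), ∀ᵐ ω ∂P, LinearIndepOn ℂ (fun i => Q i ω) (s : Set (Fin n)) := by
    intro s
    induction s using Finset.induction_on with
    | empty => simp
    | insert a s ha ih =>
      have hi : IndepFun (fun ω (i : s) => Q i ω) (Q a) P :=
        (hind.indepFun_finset₀ s {a} (by simpa using ha) fun i => (hQ i).aemeasurable).comp
          measurable_id (measurable_pi_apply (⟨a, by simp⟩ : ({a} : Finset (Fin n))))
      have hstep := IndepFun.ae_of_ae_ae hi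
        (aemeasurable_pi_lambda _ fun i : s => (hQ i).aemeasurable) (hQ a).aemeasurable
        -- A family on `Option s` is the old family with the new vector at `none`.
        (p := fun q => LinearIndependent ℂ q.1 →
          LinearIndependent ℂ (fun o : Option s => Option.casesOn' o q.2 q.1)) ?_ ?_
      · filter_upwards [ih, hstep] with ω h1 h2
        have h3 := (linearIndependent_option'.1 (h2 h1)).2
        rw [Finset.coe_insert, linearIndepOn_insert (by simpa using ha)]
        refine ⟨h1, ?_⟩
        rwa [Set.image_eq_range]
      · have h1 : MeasurableSet {q : (s → Vec n) × Vec n | LinearIndependent ℂ q.1} :=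
          (isOpen_setOfPred_linearIndependent.preimage continuous_fst).measurableSet
        have h2 : MeasurableSet {q : (s → Vec n) × Vec n |
            LinearIndependent ℂ (fun o : Option s => (Option.casesOn' o q.2 q.1 : Vec n))} := by
          refine (isOpen_setOfPred_linearIndependent.preimage (f := fun q : (s → Vec n) × Vec n =>
            fun o : Option s => (Option.casesOn' o q.2 q.1 : Vec n)) ?_).measurableSet
          refine continuous_pi fun o => ?_
          cases o
          · exact continuous_snd
          · exact (continuous_apply _).comp continuous_fst
        have : {q : (s → Vec n) × Vec n | LinearIndependent ℂ q.1 →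
            LinearIndependent ℂ (fun o : Option s => (Option.casesOn' o q.2 q.1 : Vec n))}
            = {q : (s → Vec n) × Vec n | LinearIndependent ℂ q.1}ᶜ ∪
              {q : (s → Vec n) × Vec n |
            LinearIndependent ℂ (fun o : Option s => (Option.casesOn' o q.2 q.1 : Vec n))} := by
          ext q
          simp only [Set.mem_ofPred_eq, Set.mem_union, Set.mem_compl_iff, imp_iff_not_or]
        rw [this]
        exact h1.compl.union h2
      · refine ae_of_all _ fun ω => ?_
        have hcard : s.card < n := by
          have := Finset.card_lt_univ_of_notMem ha
          simpa using this
        -- Fewer than `n` vectors span a proper subspace, which an isotropic vector almost surely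
        -- avoids.
        have hW : Submodule.span ℂ (Set.range fun i : s => Q i ω) ≠ ⊤ := by
          intro htop
          have := finrank_range_le_card (R := ℂ) fun i : s => Q i ω
          rw [Set.finrank, htop, finrank_top, finrank_euclideanSpace_fin, Fintype.card_coe] at this
          omega
        filter_upwards [(hQ a).ae_notMem hn hW] with ω' h' hLI
        exact linearIndependent_option'.2 ⟨hLI, h'⟩
  filter_upwards [key Finset.univ] with ω hω
  rwa [Finset.coe_univ, linearIndepOn_univ_iff] at hω

variable {N : ℕ} {h : Ω → Vec n} {w : Fin N → Ω → Vec n}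

theorem ae_residual_ne_zero (hn : 1 < n) (hh : AEMeasurable h P) (hh0 : ∀ᵐ ω ∂P, h ω ≠ 0)
    {X : Ω → Vec n} (hX : IsIsotropicUnit X P) (hind : IndepFun h X P) :
    ∀ᵐ ω ∂P, residual (h ω) (X ω) ≠ 0 := by
  refine IndepFun.ae_of_ae_ae hind hh hX.aemeasurable (p := fun q => residual q.1 q.2 ≠ 0)
    (measurable_residual (measurableSet_singleton 0).compl) ?_
  filter_upwards [hh0] with ω hω
  have hW : Submodule.span ℂ {h ω} ≠ ⊤ := by
    intro htop
    have := finrank_span_singleton (K := ℂ) hω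
    rw [htop, finrank_top, finrank_euclideanSpace_fin] at this
    omega
  filter_upwards [hX.ae_notMem hn hW] with ω' h'
  exact residual_ne_zero hω h'

/-- Ties are null: freeze `h`, then `w k`; the modulus for `w l` has no atom at the resulting value.
-/
theorem ae_norm_inner_ne (hn : 1 < n) (hh : AEMeasurable h P) (hh0 : ∀ᵐ ω ∂P, h ω ≠ 0)
    (hw : ∀ k, IsIsotropicUnit (w k) P) (hind : iIndepFun w P)
    (hhw : IndepFun h (fun ω k => w k ω) P) {k l : Fin N} (hkl : l ≠ k) :
    ∀ᵐ ω ∂P, ‖(inner ℂ (h ω) (w l ω) : ℂ)‖ ≠ ‖(inner ℂ (h ω) (w k ω) : ℂ)‖ := by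
  have h1 : IndepFun h (fun ω => (w k ω, w l ω)) P :=
    hhw.comp (φ := id) (ψ := fun c : Fin N → Vec n => (c k, c l)) measurable_id (by fun_prop)
  refine IndepFun.ae_of_ae_ae h1 hh ((hw k).aemeasurable.prodMk (hw l).aemeasurable)
    (p := fun q => ‖(inner ℂ q.1 q.2.2 : ℂ)‖ ≠ ‖(inner ℂ q.1 q.2.1 : ℂ)‖)
    (measurableSet_eq_fun (by fun_prop) (by fun_prop)).compl ?_
  filter_upwards [hh0] with ω hω
  refine IndepFun.ae_of_ae_ae (hind.indepFun hkl.symm) (hw k).aemeasurable (hw l).aemeasurable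
    (p := fun q => ‖(inner ℂ (h ω) q.2 : ℂ)‖ ≠ ‖(inner ℂ (h ω) q.1 : ℂ)‖)
    (measurableSet_eq_fun (by fun_prop) (by fun_prop)).compl (ae_of_all _ fun ω' => ?_)
  exact (hw l).ae_norm_inner_ne hn hω ‖(inner ℂ (h ω) (w k ω') : ℂ)‖

theorem ae_sel_eq (hn : 1 < n) (hh : AEMeasurable h P) (hh0 : ∀ᵐ ω ∂P, h ω ≠ 0)
    (hw : ∀ k, IsIsotropicUnit (w k) P) (hind : iIndepFun w P)
    (hhw : IndepFun h (fun ω k => w k ω) P) {F : Ω → Fin N}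
    (hF : ∀ ω, IsQuantIndex (h ω) (fun k => w k ω) (F ω)) :
    ∀ᵐ ω ∂P, sel (h ω) (fun k => w k ω) = w (F ω) ω := by
  have hne : ∀ᵐ ω ∂P, ∀ k l, l ≠ k →
      ‖(inner ℂ (h ω) (w l ω) : ℂ)‖ ≠ ‖(inner ℂ (h ω) (w k ω) : ℂ)‖ := by
    rw [ae_all_iff]
    intro k
    rw [ae_all_iff]
    intro l
    by_cases hkl : l = k
    · simp [hkl]
    · filter_upwards [ae_norm_inner_ne hn hh hh0 hw hind hhw hkl] with ω hω _ using hω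
  filter_upwards [hne] with ω hω
  exact sel_eq (hF ω) (hω _)

/-- The joint law is invariant when `U` acts on the channel and all codewords at once, and `sel` is
equivariant for that action. -/
theorem map_sel_map_unitary (U : Vec n ≃ₗᵢ[ℂ] Vec n) {γ : Measure (Vec n)}
    [IsProbabilityMeasure γ] {ν : Fin N → Measure (Vec n)} [∀ k, IsProbabilityMeasure (ν k)]
    (hγ : γ.map U = γ) (hν : ∀ k, (ν k).map U = ν k) :
    ((γ.prod (Measure.pi ν)).map fun p => sel p.1 p.2).map U
      = (γ.prod (Measure.pi ν)).map fun p => sel p.1 p.2 := by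
  have hsel := measurable_sel (n := n) (N := N)
  have hU : Measurable U := U.continuous.measurable
  have hUc : Measurable (fun (c : Fin N → Vec n) k => U (c k)) :=
    measurable_pi_lambda _ fun k => hU.comp (measurable_pi_apply k)
  have := fun k => Measure.isProbabilityMeasure_map (μ := ν k) hU.aemeasurable
  have hinv : (γ.prod (Measure.pi ν)).map
      (Prod.map U (fun (c : Fin N → Vec n) k => U (c k))) = γ.prod (Measure.pi ν) := by
    rw [← Measure.map_prod_map _ _ hU hUc, hγ, Measure.pi_map_pi fun k => hU.aemeasurable]
    simp_rw [hν]
  conv_rhs => rw [← hinv]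
  rw [Measure.map_map hU hsel, Measure.map_map hsel (hU.prodMap hUc)]
  congr 1
  ext1 p
  exact (sel_map_unitary U _ _).symm

/-- The quantization of an independent isotropic Gaussian vector is isotropic. -/
theorem isIsotropicUnit_sel (hn : 1 < n) (hh : HasLaw h (gaussianVec n) P)
    (hh0 : ∀ᵐ ω ∂P, h ω ≠ 0) (hw : ∀ k, IsIsotropicUnit (w k) P) (hind : iIndepFun w P)
    (hhw : IndepFun h (fun ω k => w k ω) P) {F : Ω → Fin N}
    (hF : ∀ ω, IsQuantIndex (h ω) (fun k => w k ω) (F ω)) :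
    IsIsotropicUnit (fun ω => sel (h ω) (fun k => w k ω)) P := by
  have hwm : AEMeasurable (fun ω k => w k ω) P :=
    aemeasurable_pi_lambda _ fun k => (hw k).aemeasurable
  have hGm : AEMeasurable (fun ω => (h ω, fun k => w k ω)) P := hh.aemeasurable.prodMk hwm
  have hsel := measurable_sel (n := n) (N := N)
  have hQm : AEMeasurable (fun ω => sel (h ω) (fun k => w k ω)) P :=
    hsel.comp_aemeasurable (f := fun ω => (h ω, fun k => w k ω)) hGm
  refine ⟨hQm, ?_, fun U => ?_⟩
  · have hnorm : ∀ᵐ ω ∂P, ∀ k, ‖w k ω‖ = 1 := ae_all_iff.2 fun k => (hw k).norm_eq_one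
    filter_upwards [ae_sel_eq hn hh.aemeasurable hh0 hw hind hhw hF, hnorm] with ω h1 h2
    rw [h1, h2]
  · have := fun k => Measure.isProbabilityMeasure_map (hw k).aemeasurable
    have hlaw : P.map (fun ω => sel (h ω) (fun k => w k ω))
        = ((gaussianVec n).prod (Measure.pi fun k => P.map (w k))).map fun p => sel p.1 p.2 := by
      rw [← hind.map_fun_eq_pi_map fun k => (hw k).aemeasurable, ← hh.map_eq,
        ← (indepFun_iff_map_prod_eq_prod_map_map hh.aemeasurable hwm).1 hhw,
        AEMeasurable.map_map_of_aemeasurable hsel.aemeasurable hGm]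
      rfl
    have hwU : ∀ k, (P.map (w k)).map U = P.map (w k) := fun k => by
      rw [AEMeasurable.map_map_of_aemeasurable U.continuous.measurable.aemeasurable
        (hw k).aemeasurable]
      exact (hw k).map_unitary U
    have h1 := map_sel_map_unitary U (gaussianVec_map_unitary U) hwU
    rw [← hlaw, AEMeasurable.map_map_of_aemeasurable U.continuous.measurable.aemeasurable
      hQm] at h1
    exact h1

end RandomVectors

/-! ### Fixing the vector of user `i` -/

/-- The indices other than `i`. -/
abbrev Others {n : ℕ} (i : Fin n) : Type := ↥(Finset.univ.erase i)

/-- The family which is `q` at the index `i` and `r` at the other indices. -/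
def insertAt {n : ℕ} (i : Fin n) (q : Vec n) (r : Others i → Vec n) :
    Fin n → Vec n :=
  fun k => if hk : k = i then q else r ⟨k, by simpa using hk⟩

theorem insertAt_self {n : ℕ} (i : Fin n) (q : Vec n)
    (r : Others i → Vec n) : insertAt i q r i = q := by
  simp [insertAt]

theorem insertAt_restrict {n : ℕ} (i : Fin n) (Q : Fin n → Vec n) :
    insertAt i (Q i) (fun k => Q k) = Q := by
  ext1 k
  by_cases hk : k = i
  · subst hk
    simp [insertAt]
  · simp [insertAt, hk]

theorem map_insertAt {n : ℕ} (U : Vec n → Vec n) (i : Fin n) {q : Vec n} (hq : U q = q)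
    (r : Others i → Vec n) :
    (fun k => U (insertAt i q r k)) = insertAt i q (fun k => U (r k)) := by
  ext1 k
  by_cases hk : k = i
  · simp [insertAt, hk, hq]
  · simp [insertAt, hk]

theorem measurable_insertAt {n : ℕ} (i : Fin n) :
    Measurable (fun p : Vec n × (Others i → Vec n) =>
      insertAt i p.1 p.2) := by
  refine measurable_pi_lambda _ fun k => ?_
  by_cases hk : k = i
  · simp only [insertAt, hk, dif_pos]
    exact measurable_fst
  · simp only [insertAt, hk, dif_neg, not_false_eq_true]
    exact (measurable_pi_apply _).comp measurable_snd

/-- The zero-forcing vector of index `j ≠ i` is isotropic on the orthogonal complement of the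
fixed vector `q` of index `i` when the other vectors are isotropic. -/
theorem map_inner_zfBeam {m : ℕ} (hm : 0 < m) {i j : Fin (m + 2)} (hij : i ≠ j)
    (ν : Others i → Measure (Vec (m + 2)))
    [∀ k, IsProbabilityMeasure (ν k)]
    (hν : ∀ (U : Vec (m + 2) ≃ₗᵢ[ℂ] Vec (m + 2)) k, (ν k).map U = ν k)
    {q s : Vec (m + 2)} (hq : ‖q‖ = 1) (hs : ‖s‖ = 1) (hqs : (inner ℂ q s : ℂ) = 0)
    (hLI : ∀ᵐ r ∂Measure.pi ν, LinearIndependent ℂ (insertAt i q r)) :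
    (Measure.pi ν).map (fun r => ‖(inner ℂ s (zfBeam (insertAt i q r) j) : ℂ)‖ ^ 2)
      = betaMeasure 1 m := by
  have hV : Measurable fun r => zfBeam (insertAt i q r) j :=
    (measurable_zfBeam j).comp ((measurable_insertAt i).comp measurable_prodMk_left)
  have := Measure.isProbabilityMeasure_map (μ := Measure.pi ν) hV.aemeasurable
  have h := map_inner_of_orthogonal hm hq
    ((Measure.pi ν).map fun r => zfBeam (insertAt i q r) j) ?_ ?_ ?_ hs hqs
  · rw [Measure.map_map (by fun_prop) hV] at h
    exact h
  · rw [ae_map_iff hV.aemeasurable (measurableSet_eq_fun (by fun_prop) (by fun_prop))]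
    filter_upwards [hLI] with r hr using norm_zfBeam hr j
  · rw [ae_map_iff hV.aemeasurable (measurableSet_eq_fun (by fun_prop) (by fun_prop))]
    refine ae_of_all _ fun r => ?_
    have := inner_zfBeam (insertAt i q r) hij
    rwa [insertAt_self] at this
  -- Because `U` fixes `q`, it acts on the family only through the other vectors, whose joint law it
  -- preserves.
  · intro U hU
    have hUm : Measurable U := U.continuous.measurable
    have := fun k => Measure.isProbabilityMeasure_map (μ := ν k) hUm.aemeasurable
    have hUc : Measurable (fun (r : Others i → Vec (m + 2)) k =>
        U (r k)) := measurable_pi_lambda _ fun k => hUm.comp (measurable_pi_apply k)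
    have hinv : (Measure.pi ν).map (fun r k => U (r k)) = Measure.pi ν := by
      rw [Measure.pi_map_pi fun k => hUm.aemeasurable]
      simp_rw [hν]
    conv_rhs => rw [← hinv]
    rw [Measure.map_map hUm hV, Measure.map_map hV hUc]
    congr 1
    ext1 r
    simp only [Function.comp_apply]
    rw [← zfBeam_map_unitary, map_insertAt U i hU]

/-! ### The independent Beta factor -/

section Main

variable {Ω : Type*} [MeasurableSpace Ω] {P : Measure Ω}

theorem hasLaw_gaussianVec {n : ℕ} {h : Ω → Vec n}
    (hlaw : ∀ m, HasLaw (fun ω => h ω m) complexGaussian P)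
    (hind : iIndepFun (fun m ω => h ω m) P) : HasLaw h (gaussianVec n) P := by
  have hm : ∀ m, AEMeasurable (fun ω => h ω m) P := fun m => (hlaw m).aemeasurable
  have hmeas : AEMeasurable (fun ω m => h ω m) P := aemeasurable_pi_lambda _ hm
  have hto : Measurable (WithLp.toLp 2 : (Fin n → ℂ) → Vec n) := WithLp.measurable_toLp 2 _
  refine ⟨hto.comp_aemeasurable hmeas, ?_⟩
  have h1 := hind.map_fun_eq_pi_map hm
  simp_rw [fun m => (hlaw m).map_eq] at h1
  rw [gaussianVec, ← h1, AEMeasurable.map_map_of_aemeasurable hto.aemeasurable hmeas]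
  rfl

theorem indepFun_others {n : ℕ} {α β : Type*} [MeasurableSpace α] [MeasurableSpace β]
    {G : Fin n → Ω → α} (hGm : ∀ k, AEMeasurable (G k) P) (hG : iIndepFun G P) {φ : α → β}
    (hφ : Measurable φ) (i : Fin n) :
    IndepFun (G i) (fun ω (k : Others i) => φ (G k ω)) P := by
  have hφ' : Measurable fun (r : Others i → α) (k : Others i) => φ (r k) :=
    measurable_pi_lambda _ fun k => hφ.comp (measurable_pi_apply k)
  have h : IndepFun (fun ω (k : ({i} : Finset (Fin n))) => G k ω)
      (fun ω (k : Others i) => G k ω) P :=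
    hG.indepFun_finset₀ {i} (Finset.univ.erase i) (by simp) hGm
  exact h.comp (measurable_pi_apply (⟨i, by simp⟩ : ({i} : Finset (Fin n)))) hφ'

/-- The normalized interference as a function of the channel and the codebook `g` of user `i` and
of the quantized channels `r` of the other users. -/
noncomputable def normalizedInterference {n N : ℕ} (i j : Fin n)
    (p : (Vec n × (Fin N → Vec n)) × (Others i → Vec n)) : ℝ :=
  ‖(inner ℂ (dir (residual p.1.1 (sel p.1.1 p.1.2)))
    (zfBeam (insertAt i (sel p.1.1 p.1.2) p.2) j) : ℂ)‖ ^ 2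

theorem measurable_residual_sel {n N : ℕ} :
    Measurable fun g : Vec n × (Fin N → Vec n) => residual g.1 (sel g.1 g.2) :=
  measurable_residual.comp (measurable_fst.prodMk measurable_sel)

theorem measurable_insertAt_sel {n N : ℕ} (i : Fin n) :
    Measurable fun p : (Vec n × (Fin N → Vec n)) × (Others i → Vec n) =>
      insertAt i (sel p.1.1 p.1.2) p.2 :=
  (measurable_insertAt i).comp ((measurable_sel.comp measurable_fst).prodMk measurable_snd)

theorem measurable_normalizedInterference {n N : ℕ} (i j : Fin n) :
    Measurable (normalizedInterference (N := N) i j) :=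
  (((measurable_dir.comp (measurable_residual_sel.comp measurable_fst)).inner
    ((measurable_zfBeam j).comp (measurable_insertAt_sel i))).norm).pow_const 2

section Beta

variable [IsProbabilityMeasure P] {m N : ℕ} {i j : Fin (m + 2)} {G : Fin (m + 2) → Ω → Vec (m + 2) × (Fin N → Vec (m + 2))}

/-- Once `g` is fixed, the selected codeword and the residual direction are orthogonal unit vectors,
while the other quantized channels keep their product law; `map_inner_zfBeam` applies. -/
theorem map_normalizedInterference (hm : 0 < m) (hij : i ≠ j)
    (hGm : ∀ k, AEMeasurable (G k) P) (hG : iIndepFun G P)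
    (hiso : ∀ k, IsIsotropicUnit (fun ω => sel (G k ω).1 (G k ω).2) P)
    (hres : ∀ᵐ ω ∂P, residual (G i ω).1 (sel (G i ω).1 (G i ω).2) ≠ 0) :
    ∀ᵐ g ∂P.map (G i), (P.map fun ω (k : Others i) => sel (G k ω).1 (G k ω).2).map
      (fun r => normalizedInterference i j (g, r)) = betaMeasure 1 m := by
  have hselm := measurable_sel (n := m + 2) (N := N)
  set Q : Fin (m + 2) → Ω → Vec (m + 2) := fun k ω => sel (G k ω).1 (G k ω).2
  have hQm : ∀ k, AEMeasurable (Q k) P := fun k => (hiso k).aemeasurable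
  have hQind : iIndepFun Q P := hG.comp (fun _ p => sel p.1 p.2) fun _ => hselm
  set R : Ω → Others i → Vec (m + 2) := fun ω k => Q k ω
  have hRm : AEMeasurable R P := aemeasurable_pi_lambda _ fun k => hQm k
  have hGR : IndepFun (G i) R P := indepFun_others hGm hG hselm i
  have hGRlaw := (indepFun_iff_map_prod_eq_prod_map_map (hGm i) hRm).1 hGR
  have := Measure.isProbabilityMeasure_map (hGm i)
  have := Measure.isProbabilityMeasure_map hRm
  have := fun k => Measure.isProbabilityMeasure_map (hQm k)
  have hRlaw : P.map R = Measure.pi fun k : Others i => P.map (Q k) :=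
    (hQind.precomp (g := fun k : Others i => (k : Fin (m + 2)))
      Subtype.val_injective).map_fun_eq_pi_map fun k => hQm k
  have hν : ∀ (U : Vec (m + 2) ≃ₗᵢ[ℂ] Vec (m + 2)) (k : Others i),
      (P.map (Q k)).map U = P.map (Q k) := fun U k => by
    rw [AEMeasurable.map_map_of_aemeasurable U.continuous.measurable.aemeasurable (hQm k)]
    exact (hiso k).map_unitary U
  have hLI : ∀ᵐ g ∂P.map (G i), ∀ᵐ r ∂P.map R,
      LinearIndependent ℂ (insertAt i (sel g.1 g.2) r) := by
    have hS : MeasurableSet {p : (Vec (m + 2) × (Fin N → Vec (m + 2))) × (Others i → Vec (m + 2)) |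
        LinearIndependent ℂ (insertAt i (sel p.1.1 p.1.2) p.2)} :=
      measurable_insertAt_sel i isOpen_setOfPred_linearIndependent.measurableSet
    -- Linear independence holds almost surely jointly, hence for almost every `g` and then almost
    -- every `r`.
    refine Measure.ae_ae_of_ae_prod (μ := P.map (G i)) (ν := P.map R)
      (p := fun p : (Vec (m + 2) × (Fin N → Vec (m + 2))) × (Others i → Vec (m + 2)) =>
        LinearIndependent ℂ (insertAt i (sel p.1.1 p.1.2) p.2)) ?_
    rw [← hGRlaw, ae_map_iff ((hGm i).prodMk hRm) hS]
    filter_upwards [ae_linearIndependent (by omega) hiso hQind] with ω hω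
    rwa [show insertAt i (sel (G i ω).1 (G i ω).2) (R ω) = fun k => Q k ω from
      insertAt_restrict i fun k => Q k ω]
  have h1 : ∀ᵐ g ∂P.map (G i), ‖sel g.1 g.2‖ = 1 := by
    rw [ae_map_iff (hGm i) (measurableSet_eq_fun hselm.norm measurable_const)]
    exact (hiso i).norm_eq_one
  have h2 : ∀ᵐ g ∂P.map (G i), residual g.1 (sel g.1 g.2) ≠ 0 := by
    have hS : MeasurableSet {g : Vec (m + 2) × (Fin N → Vec (m + 2)) |
        residual g.1 (sel g.1 g.2) ≠ 0} :=
      measurable_residual_sel (measurableSet_singleton 0).compl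
    rw [ae_map_iff (hGm i) hS]
    exact hres
  filter_upwards [h1, h2, hLI] with g hg1 hg2 hg3
  rw [hRlaw] at hg3 ⊢
  have hqs : (inner ℂ (sel g.1 g.2) (dir (residual g.1 (sel g.1 g.2))) : ℂ) = 0 := by
    rw [dir, inner_smul_right, inner_residual hg1, mul_zero]
  have h := map_inner_zfBeam hm hij (fun k : Others i => P.map (Q k)) hν hg1 (norm_dir hg2) hqs hg3
  simp only [normalizedInterference]
  exact h

/-- The interference is the quantization error times an independent Beta variable. -/
theorem exists_beta_factor (hm : 0 < m) (hij : i ≠ j)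
    (hGm : ∀ k, AEMeasurable (G k) P) (hG : iIndepFun G P)
    (hiso : ∀ k, IsIsotropicUnit (fun ω => sel (G k ω).1 (G k ω).2) P)
    (hx : ∀ᵐ ω ∂P, (G i ω).1 ≠ 0)
    (hres : ∀ᵐ ω ∂P, residual (G i ω).1 (sel (G i ω).1 (G i ω).2) ≠ 0) :
    ∃ Y : Ω → ℝ, HasLaw Y (betaMeasure 1 m) P ∧
      IndepFun (fun ω => quantError (G i ω).1 (sel (G i ω).1 (G i ω).2)) Y P ∧
      ∀ᵐ ω ∂P, interference (G i ω).1 (fun k => sel (G k ω).1 (G k ω).2) j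
        = quantError (G i ω).1 (sel (G i ω).1 (G i ω).2) * Y ω := by
  have := isProbabilityMeasureBeta (α := 1) (β := m) one_pos (by exact_mod_cast hm)
  set R : Ω → Others i → Vec (m + 2) := fun ω k => sel (G k ω).1 (G k ω).2
  have hRm : AEMeasurable R P := aemeasurable_pi_lambda _ fun k => (hiso k).aemeasurable
  have hGR : IndepFun (G i) R P := indepFun_others hGm hG measurable_sel i
  have hGRlaw := (indepFun_iff_map_prod_eq_prod_map_map (hGm i) hRm).1 hGR
  have := Measure.isProbabilityMeasure_map (hGm i)
  have := Measure.isProbabilityMeasure_map hRm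
  have hcond := map_normalizedInterference hm hij hGm hG hiso hres
  have hf := measurable_normalizedInterference (N := N) i j
  set Y : Ω → ℝ := fun ω => normalizedInterference i j (G i ω, R ω) with hY
  have hYm : AEMeasurable Y P :=
    hf.comp_aemeasurable (f := fun ω => (G i ω, R ω)) ((hGm i).prodMk hRm)
  have hYlaw : P.map Y = betaMeasure 1 m := by
    rw [← map_eq_of_forall_left hf hcond, ← hGRlaw,
      AEMeasurable.map_map_of_aemeasurable hf.aemeasurable ((hGm i).prodMk hRm)]
    rfl
  -- The conditional law of `Y` does not depend on `G i`, so `Y` is independent of all data of user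
  -- `i`, and in particular of the quantization error.
  have hGY : IndepFun (G i) Y P := by
    rw [indepFun_iff_map_prod_eq_prod_map_map (hGm i) hYm, hYlaw,
      ← map_prodMk_eq_prod hf hcond, ← hGRlaw, AEMeasurable.map_map_of_aemeasurable
        (measurable_fst.prodMk hf).aemeasurable ((hGm i).prodMk hRm)]
    rfl
  have hZ : (fun ω => ‖residual (G i ω).1 (sel (G i ω).1 (G i ω).2)‖ ^ 2)
      =ᵐ[P] fun ω => quantError (G i ω).1 (sel (G i ω).1 (G i ω).2) := by
    filter_upwards [hx, (hiso i).norm_eq_one] with ω h1 h2 using (quantError_eq h1 h2).symm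
  refine ⟨Y, ⟨hYm, hYlaw⟩, ?_, ?_⟩
  · have hφ : Measurable fun g : Vec (m + 2) × (Fin N → Vec (m + 2)) =>
        ‖residual g.1 (sel g.1 g.2)‖ ^ 2 := by
      have := measurable_residual_sel (n := m + 2) (N := N)
      fun_prop
    have h1 := hGY.comp hφ measurable_id
    exact h1.congr hZ (ae_eq_refl Y)
  · filter_upwards [hx, (hiso i).norm_eq_one] with ω h1 h2
    have h4 : insertAt i (sel (G i ω).1 (G i ω).2) (R ω) = fun k => sel (G k ω).1 (G k ω).2 :=
      insertAt_restrict i fun k => sel (G k ω).1 (G k ω).2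
    rw [interference_eq_mul h1 (q := fun k => sel (G k ω).1 (G k ω).2) hij h2, hY]
    simp only [normalizedInterference, h4]

end Beta

end Main

end RVQ

/-! ### Assembly of the three claims -/

theorem lemma3 {Ω : Type*} [MeasurableSpace Ω] (P : Measure Ω) [IsProbabilityMeasure P]
    (M B : ℕ) (hM : 1 < M)
    -- channel vectors, random codebooks and quantization indices of the `M` users
    (h : Fin M → Ω → RVQ.Vec M)
    (w : Fin M → Fin (2 ^ B) → Ω → RVQ.Vec M)
    (F : Fin M → Ω → Fin (2 ^ B))
    -- Rayleigh fading: the channel entries are iid unit variance complex Gaussians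
    (hh_law : ∀ i m, HasLaw (fun ω => h i ω m) RVQ.complexGaussian P)
    (hh_indep : iIndepFun (fun (p : Fin M × Fin M) ω => h p.1 ω p.2) P)
    -- random vector quantization: all codewords of all users are iid isotropic unit vectors
    (hw_law : ∀ i k, RVQ.IsIsotropicUnit (w i k) P)
    (hw_indep : iIndepFun (fun (p : Fin M × Fin (2 ^ B)) => w p.1 p.2) P)
    -- the codebooks are independent of the channels
    (hhw_indep : IndepFun (fun ω i => h i ω) (fun ω i k => w i k ω) P)
    -- every user feeds back the index of a codeword closest in angle to its channel vector
    (hF : ∀ i ω, RVQ.IsQuantIndex (h i ω) (fun k => w i k ω) (F i ω))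
    (i j : Fin M) (hij : i ≠ j) :
    (3 ≤ M → ∃ Y : Ω → ℝ,
      HasLaw Y (betaMeasure 1 ((M : ℝ) - 2)) P ∧
      IndepFun (fun ω => RVQ.quantError (h i ω) (RVQ.quantized w F ω i)) Y P ∧
      ∀ᵐ ω ∂P, RVQ.interference (h i ω) (RVQ.quantized w F ω) j =
          RVQ.quantError (h i ω) (RVQ.quantized w F ω i) * Y ω) ∧
    (M = 2 → ∀ᵐ ω ∂P,
      RVQ.interference (h i ω) (RVQ.quantized w F ω) j =
          RVQ.quantError (h i ω) (RVQ.quantized w F ω i)) ∧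
    (∀ᵐ ω ∂P, RVQ.interference (h i ω) (RVQ.quantized w F ω) j ≤
        RVQ.quantError (h i ω) (RVQ.quantized w F ω i)) := by
  have hhG : ∀ k, HasLaw (h k) (RVQ.gaussianVec M) P := fun k =>
    RVQ.hasLaw_gaussianVec (hh_law k) (hh_indep.precomp (g := fun m => (k, m)) (Prod.mk_right_injective k))
  have hhm : ∀ k, AEMeasurable (h k) P := fun k => (hhG k).aemeasurable
  have hh0 : ∀ k, ∀ᵐ ω ∂P, h k ω ≠ 0 := by
    intro k
    obtain ⟨m, rfl⟩ : ∃ m, M = m + 1 := ⟨M - 1, by omega⟩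
    refine ae_of_ae_map (p := fun x => x ≠ 0) (hhm k) ?_
    rw [(hhG k).map_eq]
    exact RVQ.gaussianVec_ae_ne_zero (by omega)
  have hwm : ∀ k, AEMeasurable (fun ω l => w k l ω) P := fun k =>
    aemeasurable_pi_lambda _ fun l => (hw_law k l).aemeasurable
  have hwk : ∀ k, iIndepFun (w k) P := fun k =>
    hw_indep.precomp (g := fun l => (k, l)) (Prod.mk_right_injective k)
  have hhw : ∀ k, IndepFun (h k) (fun ω l => w k l ω) P := fun k =>
    hhw_indep.comp (measurable_pi_apply k) (measurable_pi_apply k)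
  have hto : Measurable (WithLp.toLp 2 : (Fin M → ℂ) → RVQ.Vec M) := WithLp.measurable_toLp 2 _
  have hhind : iIndepFun h P :=
    (RVQ.iIndepFun_curry (fun p => (hh_law p.1 p.2).aemeasurable) hh_indep).comp
      (fun _ => WithLp.toLp 2) fun _ => hto
  have hwind : iIndepFun (fun k ω l => w k l ω) P :=
    RVQ.iIndepFun_curry (fun p => (hw_law p.1 p.2).aemeasurable) hw_indep
  -- Channel and codebook of one user, bundled; these pairs are independent across users.
  let G : Fin M → Ω → RVQ.Vec M × (Fin (2 ^ B) → RVQ.Vec M) := fun k ω =>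
    (h k ω, fun l => w k l ω)
  have hG : iIndepFun G P := RVQ.iIndepFun_prodMk hhm hwm hhind hwind hhw_indep
  have hGm : ∀ k, AEMeasurable (G k) P := fun k => (hhm k).prodMk (hwm k)
  have hiso : ∀ k, RVQ.IsIsotropicUnit (fun ω => RVQ.sel (G k ω).1 (G k ω).2) P := fun k =>
    RVQ.isIsotropicUnit_sel hM (hhG k) (hh0 k) (hw_law k) (hwk k) (hhw k) (hF k)
  have hsel : ∀ᵐ ω ∂P, RVQ.quantized w F ω = fun k => RVQ.sel (G k ω).1 (G k ω).2 := by
    have : ∀ᵐ ω ∂P, ∀ k, RVQ.sel (h k ω) (fun l => w k l ω) = w k (F k ω) ω :=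
      ae_all_iff.2 fun k => RVQ.ae_sel_eq hM (hhm k) (hh0 k) (hw_law k) (hwk k) (hhw k) (hF k)
    filter_upwards [this] with ω hω
    exact funext fun k => (hω k).symm
  refine ⟨fun hM3 => ?_, fun hM2 => ?_, ?_⟩
  · obtain ⟨m, rfl⟩ : ∃ m, M = m + 2 := ⟨M - 2, by omega⟩
    have hres : ∀ᵐ ω ∂P, RVQ.residual (G i ω).1 (RVQ.sel (G i ω).1 (G i ω).2) ≠ 0 := by
      -- Treating all finitely many codewords at once avoids any measurability of `F`.
      have : ∀ᵐ ω ∂P, ∀ l, RVQ.residual (h i ω) (w i l ω) ≠ 0 := ae_all_iff.2 fun l =>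
        RVQ.ae_residual_ne_zero hM (hhm i) (hh0 i) (hw_law i l)
          ((hhw i).comp measurable_id (measurable_pi_apply l))
      filter_upwards [this, hsel] with ω h1 h2
      have h3 : RVQ.sel (G i ω).1 (G i ω).2 = w i (F i ω) ω := (congrFun h2 i).symm
      rw [h3]
      exact h1 _
    obtain ⟨Y, hY, hind, hprod⟩ :=
      RVQ.exists_beta_factor (by omega) hij hGm hG hiso (hh0 i) hres
    refine ⟨Y, ?_, ?_, ?_⟩
    · convert! hY using 2
      push_cast
      ring
    · refine hind.congr ?_ (ae_eq_refl Y)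
      filter_upwards [hsel] with ω hω
      rw [hω]
    · filter_upwards [hsel, hprod] with ω hω h1
      rw [hω]
      exact h1
  · subst hM2
    filter_upwards [hsel, hh0 i, (hiso i).norm_eq_one,
      RVQ.ae_linearIndependent hM hiso
        (hG.comp (fun _ p => RVQ.sel p.1 p.2) fun _ => RVQ.measurable_sel)] with ω h1 h2 h3 h4
    rw [h1]
    exact RVQ.interference_eq_of_two h2 hij h3 h4
  -- The bound is pointwise: it needs only a nonzero channel and unit codewords.
  · filter_upwards [hh0 i, (hw_law i · |>.norm_eq_one) |> ae_all_iff.2] with ω h1 h2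
    exact RVQ.interference_le h1 hij (h2 _)
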